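/- Let $\mathbb D\subset\mathbb C$ be the open unit disc with Poincaré distance $\rho(z,w)=\operatorname{artanh}\left|\frac{z-w}{1-\bar w z}\right|$. For a connected complex manifold $M$ (Hausdorff, second countable) let $\mathcal O(\mathbb D,M)$ and $\mathcal O(M,\mathbb D)$ be the sets of holomorphic maps, and for $z,w,p\in M$, $X\in T_pM$ put $$c_M(z,w)=\sup\{\rho(F(z),F(w)):F\in\mathcal O(M,\mathbb D)\},$$ $$l_M(z,w)=\inf\{\rho(\sigma,\zeta): f\in\mathcal O(\mathbb D,M),\ f(\sigma)=z,\ f(\zeta)=w\},$$ $$\varkappa_M(p;X)=\inf\{|\alpha|: \alpha\in\mathbb C,\ f\in\mathcal O(\mathbb D,M),\ f(0)=p,\ \alpha f'(0)=X\},$$ $$\gamma_M(p;X)=\sup\{|F'(p)X|:F\in\mathcal O(M,\mathbb D),\ F(p)=0\},$$ and let $k_M$ be the largest pseudodistance with $k_M\le l_M$. The manifold $M$ is taut if every sequence in $\mathcal O(\mathbb D,M)$ has a subsequence that converges locally uniformly to an element of $\mathcal O(\mathbb D,M)$ or that is compactly divergent. It is a Lempert manifold if it is taut, $l_M=k_M=c_M$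 and $\varkappa_M=\gamma_M$. A set $\mathcal F\subset\mathcal O(M,\mathbb D)$ is a Carathéodory universal set of $M$ if $c_M(z,w)=\sup_{F\in\mathcal F}\rho(F(z),F(w))$ for all $z,w\in M$; it is minimal if no proper subset of it is one. Theorem. Let $M$ and $N$ be connected Lempert manifolds of complex dimension $2$, each of which has a minimal Carathéodory universal set that is finite and has at least three elements. Let $F:M\to N$ be a $\mathcal C^1$-smooth Kobayashi isometry, i.e. a map of class $\mathcal C^1$ in the real sense such that $$\varkappa_M(z;X)=\varkappa_N(F(z);F'(z)X)\qquad\text{for all } z\in M,\ X\in T_zM,$$ where $F'(z):T_zM\to T_{F(z)}N$ is the real ($\mathbb R$-linear) derivative. Then $F$ is holomorphic or antiholomorphic. -/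

import Mathlib

open scoped Manifold ContDiff ENNReal

/-! Complex manifolds are modelled on a finite-dimensional complex normed space `E`, with model
`𝓘(ℂ, E)`. The tangent space at each point is definitionally `E`. A holomorphic disc is given by a
map `ℂ → M`, of which only the restriction to the open unit disc matters. -/

noncomputable section

/-- The Poincaré distance on the open unit disc. -/
def poincareDist (z w : ℂ) : ℝ :=
  Real.artanh ‖(z - w) / (1 - (starRingEnd ℂ) w * z)‖

section Manifold

variable (E : Type*) [NormedAddCommGroup E] [NormedSpace ℂ E]
variable {M : Type*} [TopologicalSpace M] [ChartedSpace E M]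

/-- `f` restricts to a holomorphic map from the open unit disc to `M`. -/
def IsHolDisc (f : ℂ → M) : Prop :=
  MDifferentiableOn 𝓘(ℂ, ℂ) 𝓘(ℂ, E) f (Metric.ball 0 1)

/-- `F` is a holomorphic map from `M` to the open unit disc. -/
def IsHolToDisc (F : M → ℂ) : Prop :=
  MDifferentiable 𝓘(ℂ, E) 𝓘(ℂ, ℂ) F ∧ ∀ x, F x ∈ Metric.ball (0 : ℂ) 1

/-- The derivative `f'(0)` of a disc, a tangent vector at `f 0`. -/
def discDeriv (f : ℂ → M) : E :=
  mfderiv 𝓘(ℂ, ℂ) 𝓘(ℂ, E) f 0 (1 : ℂ)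

/-- The derivative `F'(p)X` of a function `F : M → ℂ`. -/
def funDeriv (F : M → ℂ) (p : M) (X : E) : ℂ :=
  mfderiv 𝓘(ℂ, E) 𝓘(ℂ, ℂ) F p X

/-- The Carathéodory pseudodistance. -/
def caratheodoryDist (z w : M) : ℝ≥0∞ :=
  ⨆ (F : M → ℂ) (_ : IsHolToDisc E F), ENNReal.ofReal (poincareDist (F z) (F w))

/-- The Lempert function (`∞` if no disc passes through both points). -/
def lempertFun (z w : M) : ℝ≥0∞ :=
  ⨅ (f : ℂ → M) (_ : IsHolDisc E f) (σ ∈ Metric.ball (0 : ℂ) 1) (ζ ∈ Metric.ball (0 : ℂ) 1)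
    (_ : f σ = z) (_ : f ζ = w), ENNReal.ofReal (poincareDist σ ζ)

/-- Pseudodistances (the value `∞` is allowed). -/
structure IsPseudoDist {M : Type*} (d : M → M → ℝ≥0∞) : Prop where
  self : ∀ x, d x x = 0
  symm : ∀ x y, d x y = d y x
  triangle : ∀ x y z, d x z ≤ d x y + d y z

/-- The Kobayashi pseudodistance: the largest pseudodistance not greater than the Lempert function.
A pointwise supremum of pseudodistances is a pseudodistance, so the largest one is the supremum. -/
def kobayashiDist (z w : M) : ℝ≥0∞ :=
  ⨆ (d : M → M → ℝ≥0∞) (_ : IsPseudoDist d) (_ : ∀ x y, d x y ≤ lempertFun E x y), d z w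

/-- The Kobayashi pseudometric. -/
def kobayashiMetric (p : M) (X : E) : ℝ≥0∞ :=
  ⨅ (f : ℂ → M) (_ : IsHolDisc E f) (_ : f 0 = p) (α : ℂ) (_ : α • discDeriv E f = X), ‖α‖ₑ

/-- The Carathéodory pseudometric. -/
def caratheodoryMetric (p : M) (X : E) : ℝ≥0∞ :=
  ⨆ (F : M → ℂ) (_ : IsHolToDisc E F) (_ : F p = 0), ‖funDeriv E F p X‖ₑ

variable (M) in
/-- `M` is taut: every sequence of holomorphic discs has a subsequence that converges to a
holomorphic disc uniformly on compact sets (that is, in the compact-open topology), or a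
subsequence that is compactly divergent. -/
def IsTaut : Prop :=
  ∀ f : ℕ → ℂ → M, (∀ n, IsHolDisc E (f n)) →
    ∃ φ : ℕ → ℕ, StrictMono φ ∧
      ((∃ g : ℂ → M, IsHolDisc E g ∧
          ∀ K ⊆ Metric.ball (0 : ℂ) 1, IsCompact K → ∀ U : Set M, IsOpen U → Set.MapsTo g K U →
            ∀ᶠ n in Filter.atTop, Set.MapsTo (f (φ n)) K U) ∨
        (∀ K ⊆ Metric.ball (0 : ℂ) 1, IsCompact K → ∀ L : Set M, IsCompact L →
            ∀ᶠ n in Filter.atTop, Disjoint (f (φ n) '' K) L))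

variable (M) in
/-- Lempert manifolds. -/
structure IsLempertManifold : Prop where
  taut : IsTaut E M
  lempert_eq_kobayashi : ∀ z w : M, lempertFun E z w = kobayashiDist E z w
  kobayashi_eq_caratheodory : ∀ z w : M, kobayashiDist E z w = caratheodoryDist E z w
  metric_eq : ∀ (p : M) (X : E), kobayashiMetric E p X = caratheodoryMetric E p X

/-- A set of holomorphic maps from `M` to the disc that suffices to compute the Carathéodory
pseudodistance. -/
def IsCaratheodoryUniversal (S : Set (M → ℂ)) : Prop :=
  (∀ F ∈ S, IsHolToDisc E F) ∧
    ∀ z w : M, caratheodoryDist E z w = ⨆ F ∈ S, ENNReal.ofReal (poincareDist (F z) (F w))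

/-- A minimal Carathéodory universal set (no proper subset is universal). -/
def IsMinimalCaratheodoryUniversal (S : Set (M → ℂ)) : Prop :=
  Minimal (IsCaratheodoryUniversal E) S

variable (E' : Type*) [NormedAddCommGroup E'] [NormedSpace ℂ E']
variable {N : Type*} [TopologicalSpace N] [ChartedSpace E' N]

/-- The real derivative `F'(z)`, an `ℝ`-linear map between the tangent spaces. -/
def realDeriv (F : M → N) (z : M) : E →L[ℝ] E' :=
  mfderiv 𝓘(ℝ, E) 𝓘(ℝ, E') F z

/-- A `C¹` map (in the real sense) that is an isometry for the Kobayashi metrics. -/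
structure IsKobayashiIsometry (F : M → N) : Prop where
  contMDiff : ContMDiff 𝓘(ℝ, E) 𝓘(ℝ, E') 1 F
  isometry : ∀ (z : M) (X : E),
    kobayashiMetric E z X = kobayashiMetric E' (F z) (realDeriv E E' F z X)

/-- `F` is holomorphic. -/
def IsHol (F : M → N) : Prop := MDifferentiable 𝓘(ℂ, E) 𝓘(ℂ, E') F

/-- `F` is antiholomorphic: real differentiable with conjugate-linear derivatives. -/
def IsAntiHol (F : M → N) : Prop :=
  MDifferentiable 𝓘(ℝ, E) 𝓘(ℝ, E') F ∧
    ∀ (z : M) (c : ℂ) (X : E),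
      realDeriv E E' F z (c • X) = (starRingEnd ℂ) c • realDeriv E E' F z X

end Manifold

end

/-! At a point `z` the common Kobayashi–Carathéodory norm is the maximum of the moduli of finitely
many complex functionals, the derivatives of the universal functions measured in the Poincaré metric
(`caratheodoryMetric_eq_iSup`). The real derivative of `F` carries such a norm on a complex plane to
another one. Near a vector where one functional strictly dominates, its modulus must equal that of a
pulled-back functional, and this forces the latter to be complex linear or antilinear. If no two
functionals determine the norm, at least three dominate somewhere; two of them share the same type,
and two such functionals separate vectors in dimension two, so the whole derivative has that type
(`linear_or_antilinear_or_exists_pair`).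

The exceptional case is excluded globally. Suppose two universal functions determine the norm at a
single point, and normalise them to vanish there. They form local coordinates, and extremal discs,
which exist by tautness (`IsTaut.exists_extremal_disc`), become the discs `s ↦ (s u, s v)` with `|u|
= |v| = 1`. Along these every function into the disc extends, hence it is a function on the bidisc
of the two given ones (`exists_bidisc_extension`). Schwarz–Pick on the bidisc makes the pair
universal (`norm_discAut_le_max_of_metric_eq_max`), against minimality with three elements
(`not_exists_pair_of_minimal`).

Linearity and antilinearity of the derivative are closed conditions
(`isClosed_setOf_realDeriv_smul`), mutually exclusive because the norm is positive, so connectedness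
of `M` selects one of them. -/

open scoped Manifold ContDiff ENNReal
open Metric Set Filter Topology

/-! ### Disc automorphisms and Schwarz lemmas. -/

/-- The disc automorphism that sends `a` to the origin. -/
noncomputable def discAut (a z : ℂ) : ℂ := (z - a) / (1 - (starRingEnd ℂ) a * z)

lemma poincareDist_eq (z w : ℂ) : poincareDist z w = Real.artanh ‖discAut w z‖ := rfl

lemma discAut_self (a : ℂ) : discAut a a = 0 := by simp [discAut]

lemma one_sub_conj_mul_ne_zero {a z : ℂ} (ha : ‖a‖ < 1) (hz : ‖z‖ ≤ 1) :
    1 - (starRingEnd ℂ) a * z ≠ 0 := by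
  intro h
  have h1 : (starRingEnd ℂ) a * z = 1 := (sub_eq_zero.1 h).symm
  have h2 := congrArg norm h1
  simp only [norm_mul, RCLike.norm_conj, norm_one] at h2
  nlinarith [norm_nonneg a, norm_nonneg z]

lemma normSq_one_sub_conj_mul (a z : ℂ) :
    ‖1 - (starRingEnd ℂ) a * z‖ ^ 2 - ‖z - a‖ ^ 2 = (1 - ‖a‖ ^ 2) * (1 - ‖z‖ ^ 2) := by
  simp only [Complex.sq_norm, Complex.normSq_apply]
  simp
  ring

lemma norm_discAut_le_one {a z : ℂ} (ha : ‖a‖ < 1) (hz : ‖z‖ ≤ 1) : ‖discAut a z‖ ≤ 1 := by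
  have h := normSq_one_sub_conj_mul a z
  have h0 : 0 < ‖1 - (starRingEnd ℂ) a * z‖ := norm_pos_iff.2 (one_sub_conj_mul_ne_zero ha hz)
  rw [discAut, norm_div, div_le_one h0]
  refine le_of_sq_le_sq ?_ h0.le
  have : 0 ≤ (1 - ‖a‖ ^ 2) * (1 - ‖z‖ ^ 2) :=
    mul_nonneg (by nlinarith [norm_nonneg a]) (by nlinarith [norm_nonneg z])
  linarith

lemma norm_discAut_lt_one {a z : ℂ} (ha : ‖a‖ < 1) (hz : ‖z‖ < 1) : ‖discAut a z‖ < 1 := by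
  have h := normSq_one_sub_conj_mul a z
  have h0 : 0 < ‖1 - (starRingEnd ℂ) a * z‖ := norm_pos_iff.2 (one_sub_conj_mul_ne_zero ha hz.le)
  rw [discAut, norm_div, div_lt_one h0]
  refine lt_of_pow_lt_pow_left₀ 2 h0.le ?_
  have : 0 < (1 - ‖a‖ ^ 2) * (1 - ‖z‖ ^ 2) :=
    mul_pos (by nlinarith [norm_nonneg a]) (by nlinarith [norm_nonneg z])
  linarith

lemma discAut_neg_discAut {a z : ℂ} (ha : ‖a‖ < 1) (hz : ‖z‖ ≤ 1) :
    discAut (-a) (discAut a z) = z := by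
  have h0 := one_sub_conj_mul_ne_zero ha hz
  have h1 := one_sub_conj_mul_ne_zero ha ha.le
  have h2 : 1 - (starRingEnd ℂ) a * z + (starRingEnd ℂ) a * (z - a) ≠ 0 := by
    convert h1 using 1; ring
  have h3 : 1 - (starRingEnd ℂ) (-a) * ((z - a) / (1 - (starRingEnd ℂ) a * z)) =
      (1 - (starRingEnd ℂ) a * z + (starRingEnd ℂ) a * (z - a)) / (1 - (starRingEnd ℂ) a * z) := by
    rw [map_neg, eq_div_iff h0, sub_mul, mul_assoc, div_mul_cancel₀ _ h0]; ring
  rw [discAut, discAut, h3, div_eq_iff (div_ne_zero h2 h0), sub_neg_eq_add,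
    div_add' _ _ _ h0, ← mul_div_assoc]
  congr 1
  ring

lemma hasDerivAt_discAut {a z : ℂ} (h : 1 - (starRingEnd ℂ) a * z ≠ 0) :
    HasDerivAt (discAut a)
      (((1 - (starRingEnd ℂ) a * z) + (z - a) * (starRingEnd ℂ) a) /
        (1 - (starRingEnd ℂ) a * z) ^ 2) z := by
  have h1 : HasDerivAt (fun z : ℂ => z - a) 1 z := (hasDerivAt_id z).sub_const a
  have h2 : HasDerivAt (fun z : ℂ => 1 - (starRingEnd ℂ) a * z) (-(starRingEnd ℂ) a) z := by
    simpa using ((hasDerivAt_id z).const_mul ((starRingEnd ℂ) a)).const_sub 1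
  exact (h1.div h2 h).congr_deriv (by ring)

lemma hasDerivAt_discAut_self {a : ℂ} (ha : ‖a‖ < 1) :
    HasDerivAt (discAut a) (((1 - ‖a‖ ^ 2 : ℝ) : ℂ)⁻¹) a := by
  have h := one_sub_conj_mul_ne_zero ha ha.le
  have e : ((1 - ‖a‖ ^ 2 : ℝ) : ℂ) = 1 - (starRingEnd ℂ) a * a := by
    rw [Complex.conj_mul']; push_cast; ring
  convert hasDerivAt_discAut h using 1
  rw [e]
  field_simp
  simp

lemma differentiableOn_discAut {a : ℂ} (ha : ‖a‖ < 1) :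
    DifferentiableOn ℂ (discAut a) (ball 0 1) := fun _ hz =>
  (hasDerivAt_discAut (one_sub_conj_mul_ne_zero ha
    (mem_ball_zero_iff.1 hz).le)).differentiableAt.differentiableWithinAt

/-- The **Schwarz-Pick lemma**. -/
lemma norm_discAut_le_of_mapsTo {f : ℂ → ℂ} (hf : DifferentiableOn ℂ f (ball 0 1))
    (hm : MapsTo f (ball 0 1) (closedBall 0 1)) {z w : ℂ} (hz : ‖z‖ < 1) (hw : ‖w‖ < 1)
    (hfw : ‖f w‖ < 1) : ‖discAut (f w) (f z)‖ ≤ ‖discAut w z‖ := by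
  have hw' : ‖-w‖ < 1 := by simpa
  set g : ℂ → ℂ := fun t => discAut (f w) (f (discAut (-w) t)) with hg
  have hmw : MapsTo (discAut (-w)) (ball 0 1) (ball 0 1) := fun t ht =>
    mem_ball_zero_iff.2 (norm_discAut_lt_one hw' (mem_ball_zero_iff.1 ht))
  have hgd : DifferentiableOn ℂ g (ball 0 1) := by
    have h1 : DifferentiableOn ℂ (fun t => f (discAut (-w) t)) (ball 0 1) :=
      hf.comp (differentiableOn_discAut hw') hmw
    intro t ht
    have hb : ‖f (discAut (-w) t)‖ ≤ 1 := mem_closedBall_zero_iff.1 (hm (hmw ht))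
    exact (hasDerivAt_discAut (one_sub_conj_mul_ne_zero hfw hb)).differentiableAt.comp_differentiableWithinAt
      t (h1 t ht)
  have hgm : MapsTo g (ball 0 1) (closedBall 0 1) := fun t ht =>
    mem_closedBall_zero_iff.2 (norm_discAut_le_one hfw (mem_closedBall_zero_iff.1 (hm (hmw ht))))
  have hg0 : g 0 = 0 := by
    have : discAut (-w) 0 = w := by simp [discAut]
    simp only [hg, this, discAut_self]
  have := Complex.norm_le_norm_of_mapsTo_ball hgd hgm hg0 (norm_discAut_lt_one hw hz)
  simpa only [hg, discAut_neg_discAut hw hz.le] using this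

lemma poincareDist_le_iff {a b c d : ℂ} (ha : ‖a‖ < 1) (hb : ‖b‖ < 1) (hc : ‖c‖ < 1)
    (hd : ‖d‖ < 1) : poincareDist a b ≤ poincareDist c d ↔ ‖discAut b a‖ ≤ ‖discAut d c‖ := by
  rw [poincareDist_eq, poincareDist_eq]
  refine Real.artanh_le_artanh_iff ?_ ?_
  · exact ⟨by linarith [norm_nonneg (discAut b a)], norm_discAut_lt_one hb ha⟩
  · exact ⟨by linarith [norm_nonneg (discAut d c)], norm_discAut_lt_one hd hc⟩

lemma poincareDist_nonneg (a b : ℂ) : 0 ≤ poincareDist a b :=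
  Real.artanh_nonneg (norm_nonneg _)

/-- Stability in the Schwarz lemma: `f s / s` maps the disc to the closed disc, so Schwarz–Pick
keeps it close to its value at the origin when that value is close to the unit circle. -/
lemma norm_sub_le_of_schwarz {f : ℂ → ℂ} (hf : DifferentiableOn ℂ f (ball 0 1))
    (hm : MapsTo f (ball 0 1) (closedBall 0 1)) (h0 : f 0 = 0) {s : ℂ} (hs : ‖s‖ < 1) :
    ‖f s - deriv f 0 * s‖ ≤ (1 - ‖deriv f 0‖ ^ 2) / (1 - ‖s‖) := by
  have hm' : MapsTo f (ball 0 1) (closedBall (f 0) 1) := by rwa [h0]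
  set k : ℂ → ℂ := dslope f 0 with hk
  have hkd : DifferentiableOn ℂ k (ball 0 1) :=
    (Complex.differentiableOn_dslope (ball_mem_nhds 0 one_pos)).2 hf
  have hk0 : k 0 = deriv f 0 := dslope_same f 0
  have hkm : MapsTo k (ball 0 1) (closedBall 0 1) := fun z hz => by
    simpa using Complex.norm_dslope_le_div_of_mapsTo_ball hf hm' hz
  have hfk : f s = k s * s := by
    have := sub_smul_dslope f 0 s
    simp only [sub_zero, h0, smul_eq_mul] at this
    rw [hk, mul_comm, this]
  have hc : ‖k 0‖ ≤ 1 := mem_closedBall_zero_iff.1 (hkm (mem_ball_self one_pos))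
  have hs1 : 0 < 1 - ‖s‖ := by linarith
  rw [← hk0]
  rcases hc.lt_or_eq with hc | hc
  · have h1 := norm_discAut_le_of_mapsTo hkd hkm hs (by simp : ‖(0 : ℂ)‖ < 1) hc
    have h2 : discAut 0 s = s := by simp [discAut]
    have hks : ‖k s‖ ≤ 1 := mem_closedBall_zero_iff.1 (hkm (mem_ball_zero_iff.2 hs))
    have h3 : 0 < ‖1 - (starRingEnd ℂ) (k 0) * k s‖ :=
      norm_pos_iff.2 (one_sub_conj_mul_ne_zero hc hks)
    rw [h2, discAut, norm_div, div_le_iff₀ h3] at h1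
    -- This lets the Schwarz–Pick inequality for `k` be solved for `‖k s - k 0‖`.
    have h4 : ‖1 - (starRingEnd ℂ) (k 0) * k s‖ ≤ (1 - ‖k 0‖ ^ 2) + ‖k s - k 0‖ := by
      have e : 1 - (starRingEnd ℂ) (k 0) * k s =
          ((1 - ‖k 0‖ ^ 2 : ℝ) : ℂ) - (starRingEnd ℂ) (k 0) * (k s - k 0) := by
        have : (starRingEnd ℂ) (k 0) * k 0 = (‖k 0‖ : ℂ) ^ 2 := Complex.conj_mul' _
        push_cast
        linear_combination -this
      rw [e]
      refine (norm_sub_le _ _).trans (add_le_add ?_ ?_)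
      · rw [Complex.norm_real, Real.norm_of_nonneg]
        nlinarith [norm_nonneg (k 0)]
      · rw [norm_mul, RCLike.norm_conj]
        nlinarith [norm_nonneg (k s - k 0)]
    have h5 : ‖k s - k 0‖ ≤ (1 - ‖k 0‖ ^ 2) / (1 - ‖s‖) := by
      rw [le_div_iff₀ hs1]
      have : 0 ≤ 1 - ‖k 0‖ ^ 2 := by nlinarith [norm_nonneg (k 0)]
      nlinarith [norm_nonneg s, mul_le_mul_of_nonneg_left h4 (norm_nonneg s)]
    rw [hfk, ← sub_mul, norm_mul]
    nlinarith [norm_nonneg s, norm_nonneg (k s - k 0)]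
  · have h1 := Complex.affine_of_mapsTo_ball_of_norm_dslope_eq_div hf hm'
      (mem_ball_self one_pos) (by simpa [hk] using hc) (mem_ball_zero_iff.2 hs)
    simp only [h0, sub_zero, zero_add, smul_eq_mul] at h1
    rw [h1, hc]
    simp [hk, mul_comm]

lemma tendsto_of_schwarz {f : ℕ → ℂ → ℂ} (hf : ∀ n, DifferentiableOn ℂ (f n) (ball 0 1))
    (hm : ∀ n, MapsTo (f n) (ball 0 1) (closedBall 0 1)) (h0 : ∀ n, f n 0 = 0) {c : ℂ}
    (hc : ‖c‖ = 1) (hlim : Tendsto (fun n => deriv (f n) 0) atTop (𝓝 c)) {s : ℂ} (hs : ‖s‖ < 1) :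
    Tendsto (fun n => f n s) atTop (𝓝 (c * s)) := by
  have h1 : Tendsto (fun n => f n s - deriv (f n) 0 * s) atTop (𝓝 0) := by
    refine squeeze_zero_norm (fun n => norm_sub_le_of_schwarz (hf n) (hm n) (h0 n) hs) ?_
    have : Tendsto (fun n => (1 - ‖deriv (f n) 0‖ ^ 2) / (1 - ‖s‖)) atTop
        (𝓝 ((1 - ‖c‖ ^ 2) / (1 - ‖s‖))) :=
      ((hlim.norm.pow 2).const_sub 1).div_const _
    simpa [hc] using this
  simpa using h1.add (hlim.mul_const s)

/-! ### Extension of holomorphic germs to the bidisc. -/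

/-- A function on a subset of a complex normed space is holomorphic along discs if its composition
with every holomorphic map from a planar domain is holomorphic. -/
def HolAlongDiscs {V : Type*} [NormedAddCommGroup V] [NormedSpace ℂ V] (H : V → ℂ) (B : Set V) :
    Prop :=
  ∀ (T : Set ℂ) (φ : ℂ → V), IsOpen T → DifferentiableOn ℂ φ T → MapsTo φ T B →
    DifferentiableOn ℂ (fun t => H (φ t)) T

lemma norm_le_of_sphere {h : ℂ → ℂ} {R ρ C : ℝ} (hh : DifferentiableOn ℂ h (ball 0 R))
    (hρ : 0 < ρ) (hR : ρ < R) (hb : ∀ z, ‖z‖ = ρ → ‖h z‖ ≤ C) {z : ℂ} (hz : ‖z‖ ≤ ρ) :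
    ‖h z‖ ≤ C := by
  refine Complex.norm_le_of_forall_mem_frontier_norm_le (U := ball 0 ρ) isBounded_ball
    ((hh.mono (closedBall_subset_ball hR)).diffContOnCl_ball subset_rfl) ?_ ?_
  · rw [frontier_ball _ hρ.ne']
    exact fun w hw => hb w (mem_sphere_zero_iff_norm.1 hw)
  · rw [closure_ball _ hρ.ne']
    exact mem_closedBall_zero_iff.2 hz

/-- The maximum principle in one variable at a time: the torus controls the closed bidisc. -/
lemma HolAlongDiscs.norm_le_of_torus {H : ℂ × ℂ → ℂ} {R ρ C : ℝ}
    (hH : HolAlongDiscs H (ball 0 R)) (hρ : 0 < ρ) (hR : ρ < R)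
    (hb : ∀ u v : ℂ, ‖u‖ = ρ → ‖v‖ = ρ → ‖H (u, v)‖ ≤ C) {x : ℂ × ℂ} (hx : ‖x‖ ≤ ρ) :
    ‖H x‖ ≤ C := by
  have key : ∀ u v : ℂ, ‖u‖ < R → ‖v‖ < R → (u, v) ∈ ball (0 : ℂ × ℂ) R := fun u v hu hv => by
    rw [mem_ball_zero_iff, Prod.norm_def]; exact max_lt hu hv
  obtain ⟨a, b⟩ := x
  have ha : ‖a‖ ≤ ρ := (le_max_left _ _).trans hx
  have hb' : ‖b‖ ≤ ρ := (le_max_right _ _).trans hx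
  have h1 : ∀ v : ℂ, ‖v‖ = ρ → ‖H (a, v)‖ ≤ C := fun v hv => by
    refine norm_le_of_sphere (h := fun t => H (t, v)) (R := R) ?_ hρ hR (fun u hu => hb u v hu hv)
      ha
    refine hH (ball 0 R) (fun t => (t, v)) isOpen_ball (by fun_prop) fun t ht => ?_
    exact key _ _ (mem_ball_zero_iff.1 ht) (by linarith)
  refine norm_le_of_sphere (h := fun t => H (a, t)) (R := R) ?_ hρ hR h1 hb'
  refine hH (ball 0 R) (fun t => (a, t)) isOpen_ball (by fun_prop) fun t ht => ?_
  exact key _ _ (by linarith) (mem_ball_zero_iff.1 ht)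

lemma differentiableOn_intervalIntegral {f : ℂ → ℝ → ℂ} {T : Set ℂ} (hT : IsOpen T) {a b C : ℝ}
    (hc : ∀ t ∈ T, Continuous (f t)) (hd : ∀ θ, DifferentiableOn ℂ (fun t => f t θ) T)
    (hb : ∀ t ∈ T, ∀ θ, ‖f t θ‖ ≤ C) :
    DifferentiableOn ℂ (fun t => ∫ θ in a..b, f t θ) T := by
  intro t₀ ht₀
  obtain ⟨r, hr, hrT⟩ := Metric.isOpen_iff.1 hT t₀ ht₀
  have hsub : ∀ t ∈ ball t₀ (r / 2), closedBall t (r / 3) ⊆ T := fun t ht z hz => hrT <| by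
    rw [mem_ball] at ht ⊢
    rw [mem_closedBall] at hz
    linarith [dist_triangle z t t₀]
  have hmem : ∀ t ∈ ball t₀ (r / 2), t ∈ T := fun t ht =>
    hsub t ht (mem_closedBall_self (by linarith))
  have hder : ∀ t ∈ T, ∀ θ, HasDerivAt (fun t => f t θ) (deriv (fun t => f t θ) t) t :=
    fun t ht θ => ((hd θ).differentiableAt (hT.mem_nhds ht)).hasDerivAt
  -- Continuity in `θ` is known for `f` only, so its derivative is handled as a limit of difference
  -- quotients. The index shift by `N` keeps the sample points inside `T`.
  have hmeas : MeasureTheory.AEStronglyMeasurable (fun θ => deriv (fun t => f t θ) t₀)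
      (MeasureTheory.volume.restrict (Set.uIoc a b)) := by
    have hu : Tendsto (fun n : ℕ => ((n : ℂ) + 1)⁻¹) atTop (𝓝[≠] 0) := by
      refine tendsto_nhdsWithin_iff.2 ⟨?_, Eventually.of_forall fun n => ?_⟩
      · simpa using tendsto_one_div_add_atTop_nhds_zero_nat (𝕜 := ℂ)
      · exact inv_ne_zero (Nat.cast_add_one_ne_zero n)
    obtain ⟨N, hN⟩ := eventually_atTop.1 <|
      ((tendsto_nhdsWithin_iff.1 hu).1.const_add t₀).eventually
        ((by simpa using hT.mem_nhds ht₀ : T ∈ 𝓝 (t₀ + 0)))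
    refine aestronglyMeasurable_of_tendsto_ae atTop
      (f := fun n θ => (((n + N : ℕ) : ℂ) + 1)⁻¹⁻¹ •
        (f (t₀ + (((n + N : ℕ) : ℂ) + 1)⁻¹) θ - f t₀ θ)) (fun n => ?_) ?_
    · exact (((hc _ (hN (n + N) (Nat.le_add_left N n))).sub (hc _ ht₀)).const_smul
        ((((n + N : ℕ) : ℂ) + 1)⁻¹⁻¹)).aestronglyMeasurable
    · refine Eventually.of_forall fun θ => ?_
      exact ((hder t₀ ht₀ θ).tendsto_slope_zero).comp (hu.comp (tendsto_add_atTop_nat N))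
  have := intervalIntegral.hasDerivAt_integral_of_dominated_loc_of_deriv_le
    (μ := MeasureTheory.volume) (a := a) (b := b)
    (F := f) (F' := fun t θ => deriv (fun t => f t θ) t) (x₀ := t₀) (s := ball t₀ (r / 2))
    (bound := fun _ => C / (r / 3)) (ball_mem_nhds _ (by linarith))
    (by filter_upwards [hT.mem_nhds ht₀] with t ht using (hc t ht).aestronglyMeasurable)
    ((hc t₀ ht₀).intervalIntegrable _ _) hmeas
    (Eventually.of_forall fun θ _ t ht => ?_) (by simp)
    (Eventually.of_forall fun θ _ t ht => hder t (hmem t ht) θ)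
  · exact this.2.differentiableAt.differentiableWithinAt
  · refine Complex.norm_deriv_le_of_forall_mem_sphere_norm_le (by linarith) ?_ ?_
    · exact (((hd θ).mono (hsub t ht))).diffContOnCl_ball subset_rfl
    · exact fun z hz => hb z (hsub t ht (sphere_subset_closedBall hz)) θ

/-- The homogeneous part of degree `n` of the Taylor expansion of `G` at the origin. -/
noncomputable def homogeneousPart (G : ℂ × ℂ → ℂ) (n : ℕ) (x : ℂ × ℂ) : ℂ :=
  (n.factorial : ℂ)⁻¹ * iteratedDeriv n (fun s : ℂ => G (s • x)) 0

section

variable {G : ℂ × ℂ → ℂ} {ε : ℝ}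

lemma differentiableOn_ray (hG : DifferentiableOn ℂ G (ball 0 ε)) {x : ℂ × ℂ} {R r : ℝ}
    (hx : ‖x‖ ≤ R) (hR : 0 < R) (hr : r * R ≤ ε) :
    DifferentiableOn ℂ (fun s : ℂ => G (s • x)) (ball 0 r) := by
  refine hG.comp (by fun_prop) fun s hs => ?_
  rw [mem_ball_zero_iff] at hs ⊢
  rw [norm_smul]
  calc ‖s‖ * ‖x‖ ≤ ‖s‖ * R := by gcongr
    _ < r * R := by gcongr
    _ ≤ ε := hr

/-- Cauchy's formula on a small circle writes the homogeneous part as an integral of values of `G`.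
Radius `2` leaves room around the closed unit bidisc for the maximum principle. -/
lemma holAlongDiscs_homogeneousPart (hε : 0 < ε) (hG : DifferentiableOn ℂ G (ball 0 ε))
    (hb : ∀ x ∈ ball 0 ε, ‖G x‖ ≤ 1) (n : ℕ) : HolAlongDiscs (homogeneousPart G n) (ball 0 2) := by
  intro T φ hT hφ hm
  -- With `‖x‖ < 2`, the ray through `x` is controlled on the disc of radius `2 * r`, which contains
  -- the closed disc of radius `r`.
  set r := ε / 4 with hr
  have hr0 : 0 < r := by positivity
  have hform : ∀ t ∈ T, homogeneousPart G n (φ t) =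
      (2 * Real.pi * Complex.I)⁻¹ * ∫ θ in (0)..2 * Real.pi, deriv (circleMap 0 r) θ *
        (1 / (circleMap 0 r θ - 0) ^ (n + 1) * G (circleMap 0 r θ • φ t)) := by
    intro t ht
    have h1 := DifferentiableOn.circleIntegral_one_div_sub_center_pow_smul hr0 n
      ((differentiableOn_ray hG (R := 2) (r := 2 * r) (mem_ball_zero_iff.1 (hm ht)).le two_pos
        (by rw [hr]; linarith)).mono (closedBall_subset_ball (by linarith)))
    simp only [circleIntegral, smul_eq_mul] at h1
    rw [h1, homogeneousPart]
    have : (2 * Real.pi * Complex.I : ℂ) ≠ 0 := by simp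
    field_simp
  have hmem : ∀ t ∈ T, ∀ θ, circleMap 0 r θ • φ t ∈ ball (0 : ℂ × ℂ) ε := fun t ht θ => by
    have h2 := mem_ball_zero_iff.1 (hm ht)
    rw [mem_ball_zero_iff, norm_smul, norm_circleMap_zero, abs_of_pos hr0]
    nlinarith
  refine DifferentiableOn.congr (DifferentiableOn.const_mul ?_ _) hform
  refine differentiableOn_intervalIntegral hT (C := r * (1 / r ^ (n + 1) * 1)) ?_ ?_ ?_
  · intro t ht
    have hne : ∀ θ, circleMap 0 r θ ≠ 0 := fun θ => circleMap_ne_center hr0.ne'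
    have h3 : Continuous fun θ => G (circleMap 0 r θ • φ t) :=
      hG.continuousOn.comp_continuous (by fun_prop) (hmem t ht)
    simp only [deriv_circleMap, sub_zero]
    refine Continuous.mul (by fun_prop) (Continuous.mul ?_ h3)
    exact continuous_const.div (by fun_prop) fun θ => pow_ne_zero _ (hne θ)
  · intro θ
    refine (DifferentiableOn.const_mul ?_ _).const_mul _
    exact hG.comp (hφ.const_smul (circleMap 0 r θ)) fun t ht => hmem t ht θ
  · intro t ht θ
    simp only [deriv_circleMap, sub_zero, norm_mul, norm_div, norm_pow, norm_circleMap_zero,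
      abs_of_pos hr0, Complex.norm_I, mul_one, norm_one]
    gcongr
    nlinarith [hb _ (hmem t ht θ), show 0 < 1 / r ^ (n + 1) by positivity]

lemma homogeneousPart_smul (hε : 0 < ε) (hG : DifferentiableOn ℂ G (ball 0 ε)) (n : ℕ) {c : ℂ}
    (hc : ‖c‖ ≤ 1) {x : ℂ × ℂ} (hx : ‖x‖ ≤ 1) :
    homogeneousPart G n (c • x) = c ^ n * homogeneousPart G n x := by
  have hd := differentiableOn_ray hG (R := 1) (r := ε) hx one_pos (by simp)
  have h0 : (0 : ℂ) ∈ ball (0 : ℂ) ε := mem_ball_self hε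
  have := iteratedDerivWithin_comp_const_smul (n := n) h0 isOpen_ball.uniqueDiffOn
    (hd.contDiffOn isOpen_ball) c (fun s hs => by
      rw [mem_ball_zero_iff] at hs ⊢
      rw [norm_mul]
      nlinarith [norm_nonneg s])
  rw [iteratedDerivWithin_of_isOpen isOpen_ball h0, mul_zero,
    iteratedDerivWithin_of_isOpen isOpen_ball h0] at this
  have e : (fun s : ℂ => G (s • c • x)) = fun s => G ((c * s) • x) := by
    funext s; rw [smul_smul, mul_comm]
  rw [homogeneousPart, homogeneousPart, e, this, smul_eq_mul]
  ring

end

lemma norm_iteratedDeriv_le_factorial {g : ℂ → ℂ} (hg : DifferentiableOn ℂ g (ball 0 1))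
    (hb : ∀ s ∈ ball 0 1, ‖g s‖ ≤ 1) (n : ℕ) : ‖iteratedDeriv n g 0‖ ≤ n.factorial := by
  have h1 : ∀ R ∈ Ioo (0 : ℝ) 1, ‖iteratedDeriv n g 0‖ ≤ n.factorial * 1 / R ^ n := fun R hR =>
    Complex.norm_iteratedDeriv_le_of_forall_mem_sphere_norm_le n hR.1
      ((hg.mono (closedBall_subset_ball hR.2)).diffContOnCl_ball subset_rfl)
      fun z hz => hb z (closedBall_subset_ball hR.2 (sphere_subset_closedBall hz))
  have h2 : Tendsto (fun R : ℝ => n.factorial * 1 / R ^ n) (𝓝[<] 1)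
      (𝓝 (n.factorial * 1 / 1 ^ n)) :=
    ((tendsto_const_nhds.div (tendsto_id.pow n) (by simp))).mono_left nhdsWithin_le_nhds
  refine (ge_of_tendsto h2 ?_).trans_eq (by simp)
  filter_upwards [Ioo_mem_nhdsLT one_pos] with R hR using h1 R hR

/-- A bounded holomorphic germ at the origin of `ℂ²` extends to the bidisc if it extends along all
the discs `s ↦ (s u, s v)` with `|u| = |v| = 1`. -/
theorem exists_bidisc_extension {G : ℂ × ℂ → ℂ} {ε : ℝ} (hε : 0 < ε)
    (hG : DifferentiableOn ℂ G (ball 0 ε)) (hb : ∀ x ∈ ball 0 ε, ‖G x‖ ≤ 1)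
    (ht : ∀ u v : ℂ, ‖u‖ = 1 → ‖v‖ = 1 → ∃ g : ℂ → ℂ, DifferentiableOn ℂ g (ball 0 1) ∧
      (∀ s ∈ ball 0 1, ‖g s‖ ≤ 1) ∧ g =ᶠ[𝓝 0] fun s => G (s • (u, v))) :
    ∃ H : ℂ × ℂ → ℂ, H =ᶠ[𝓝 0] G ∧ HolAlongDiscs H (ball 0 1) ∧ ∀ x ∈ ball 0 1, ‖H x‖ ≤ 1 := by
  have hQ := holAlongDiscs_homogeneousPart hε hG hb
  -- On the torus the homogeneous parts are the Taylor coefficients of the extension `g`, hence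
  -- bounded by one.
  have htorus : ∀ n (u v : ℂ), ‖u‖ = 1 → ‖v‖ = 1 → ‖homogeneousPart G n (u, v)‖ ≤ 1 := by
    intro n u v hu hv
    obtain ⟨g, hgd, hgb, hge⟩ := ht u v hu hv
    rw [homogeneousPart, ← (hge.iteratedDeriv n).eq_of_nhds, norm_mul, norm_inv]
    have h0 : (0 : ℝ) < n.factorial := by positivity
    rw [Complex.norm_natCast, inv_mul_le_iff₀ h0, mul_one]
    exact norm_iteratedDeriv_le_factorial hgd hgb n
  have hball : ∀ n (x : ℂ × ℂ), ‖x‖ ≤ 1 → ‖homogeneousPart G n x‖ ≤ 1 := fun n x hx =>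
    (hQ n).norm_le_of_torus one_pos one_lt_two (htorus n) hx
  have hpow : ∀ n (x : ℂ × ℂ), ‖x‖ ≤ 1 → ‖homogeneousPart G n x‖ ≤ ‖x‖ ^ n := by
    intro n x hx
    rcases eq_or_ne x 0 with rfl | hx0
    · have h := homogeneousPart_smul hε hG n (c := 0) (x := (0 : ℂ × ℂ)) (by simp) (by simp)
      rw [zero_smul] at h
      rw [h, norm_mul, norm_pow, norm_zero, norm_zero]
      exact mul_le_of_le_one_right (by positivity) (hball n 0 (by simp))
    · have h1 : ‖((‖x‖ : ℂ)⁻¹ • x)‖ ≤ 1 := by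
        rw [norm_smul, norm_inv, Complex.norm_real, norm_norm,
          inv_mul_cancel₀ (norm_ne_zero_iff.2 hx0)]
      have h2 := homogeneousPart_smul hε hG n (c := (‖x‖ : ℂ)) (by simpa using hx) h1
      rw [smul_inv_smul₀ (by simpa using hx0)] at h2
      rw [h2, norm_mul, norm_pow, Complex.norm_real, norm_norm]
      exact mul_le_of_le_one_right (by positivity) (hball n _ h1)
  -- The geometric bound `hpow` makes the homogeneous expansion converge locally uniformly on the
  -- whole bidisc, beyond the ball where `G` is given.
  set H : ℂ × ℂ → ℂ := fun x => ∑' n, homogeneousPart G n x with hHdef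
  have hH : HolAlongDiscs H (ball 0 1) := by
    intro T φ hT hφ hm t₀ ht₀
    have h1 : ‖φ t₀‖ < 1 := mem_ball_zero_iff.1 (hm ht₀)
    obtain ⟨ρ, hρ1, hρ2⟩ := exists_between h1
    have hρ0 : 0 ≤ ρ := (norm_nonneg _).trans hρ1.le
    have hopen : IsOpen (T ∩ φ ⁻¹' ball 0 ρ) := hφ.continuousOn.isOpen_inter_preimage hT isOpen_ball
    have hsub : T ∩ φ ⁻¹' ball 0 ρ ⊆ T := inter_subset_left
    have := Complex.differentiableOn_tsum_of_summable_norm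
      (F := fun n t => homogeneousPart G n (φ t)) (U := T ∩ φ ⁻¹' ball 0 ρ)
      (summable_geometric_of_lt_one hρ0 hρ2)
      (fun n => hQ n _ φ hopen (hφ.mono hsub) fun t ht => ball_subset_ball (by norm_num) (hm ht.1))
      hopen (fun n t ht => ?_)
    · exact (this.differentiableAt
        (hopen.mem_nhds ⟨ht₀, mem_ball_zero_iff.2 hρ1⟩)).differentiableWithinAt
    · have h2 : ‖φ t‖ < ρ := mem_ball_zero_iff.1 ht.2
      exact (hpow n _ (h2.le.trans hρ2.le)).trans (by gcongr)
  refine ⟨H, ?_, hH, ?_⟩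
  -- Halving `ε` puts `s = 1` inside the disc of radius `2` where the ray function is holomorphic,
  -- so its Taylor series there sums to `G x`.
  · filter_upwards [ball_mem_nhds (0 : ℂ × ℂ) (half_pos hε)] with x hx
    have hd := differentiableOn_ray hG (R := ε / 2) (r := 2) (mem_ball_zero_iff.1 hx).le
      (half_pos hε) (by linarith)
    have := Complex.hasSum_taylorSeries_on_ball hd (z := 1) (by simp)
    simp only [sub_zero, one_pow, one_smul, one_mul, smul_eq_mul] at this
    exact this.tsum_eq
  · intro x hx
    obtain ⟨ρ, hρ1, hρ2⟩ := exists_between (mem_ball_zero_iff.1 hx)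
    rcases (norm_nonneg x).trans hρ1.le |>.eq_or_lt with h0 | hρ0
    · linarith [norm_nonneg x]
    -- On the torus of radius `ρ` the series for `H` is the Taylor series at `ρ` of one of the
    -- extensions `g`, which is bounded by one.
    refine hH.norm_le_of_torus hρ0 hρ2 (fun a b ha hb' => ?_) hρ1.le
    have hρc : (ρ : ℂ) ≠ 0 := by exact_mod_cast hρ0.ne'
    have hn : ∀ a : ℂ, ‖a‖ = ρ → ‖a / ρ‖ = 1 := fun a ha => by
      rw [norm_div, Complex.norm_real, ha, Real.norm_of_nonneg hρ0.le, div_self hρ0.ne']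
    have hab : (a, b) = (ρ : ℂ) • (a / (ρ : ℂ), b / (ρ : ℂ)) := by
      ext <;> simp <;> field_simp
    obtain ⟨g, hgd, hgb, hge⟩ := ht (a / ρ) (b / ρ) (hn a ha) (hn b hb')
    have hρm : (ρ : ℂ) ∈ ball (0 : ℂ) 1 := by
      simpa [abs_of_pos hρ0] using hρ2
    have hs := Complex.hasSum_taylorSeries_on_ball hgd hρm
    have : H (a, b) = g ρ := by
      rw [← hs.tsum_eq, hHdef]
      refine tsum_congr fun n => ?_
      rw [hab, homogeneousPart_smul hε hG n (mem_ball_zero_iff.1 hρm).le, homogeneousPart,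
        ← (hge.iteratedDeriv n).eq_of_nhds]
      · simp only [sub_zero, smul_eq_mul]; ring
      · rw [Prod.norm_def]; exact max_le (hn a ha).le (hn b hb').le
    rw [this]
    exact hgb _ hρm

/-- The **Schwarz-Pick lemma** on the bidisc. -/
lemma HolAlongDiscs.norm_discAut_le {H : ℂ × ℂ → ℂ} (hH : HolAlongDiscs H (ball 0 1))
    (hb : ∀ x ∈ ball 0 1, ‖H x‖ ≤ 1) {x y : ℂ × ℂ} (hx : ‖x‖ < 1) (hy : ‖y‖ < 1)
    (hHy : ‖H y‖ < 1) :
    ‖discAut (H y) (H x)‖ ≤ max ‖discAut y.1 x.1‖ ‖discAut y.2 x.2‖ := by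
  have hx1 : ‖x.1‖ < 1 := (norm_fst_le x).trans_lt hx
  have hx2 : ‖x.2‖ < 1 := (norm_snd_le x).trans_lt hx
  have hy1 : ‖y.1‖ < 1 := (norm_fst_le y).trans_lt hy
  have hy2 : ‖y.2‖ < 1 := (norm_snd_le y).trans_lt hy
  set τ : ℂ × ℂ := (discAut y.1 x.1, discAut y.2 x.2) with hτ
  have hτ1 : ‖τ‖ < 1 := by
    rw [Prod.norm_def]; exact max_lt (norm_discAut_lt_one hy1 hx1) (norm_discAut_lt_one hy2 hx2)
  have hmax : max ‖discAut y.1 x.1‖ ‖discAut y.2 x.2‖ = ‖τ‖ := (Prod.norm_def τ).symm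
  rw [hmax]
  set ψ : ℂ × ℂ → ℂ × ℂ := fun p => (discAut (-y.1) p.1, discAut (-y.2) p.2) with hψ
  have hψx : ψ τ = x := by
    rw [hψ]
    exact Prod.ext (discAut_neg_discAut hy1 hx1.le) (discAut_neg_discAut hy2 hx2.le)
  have hψ0 : ψ 0 = y := by
    rw [hψ]
    exact Prod.ext (by simp [discAut]) (by simp [discAut])
  rcases eq_or_ne τ 0 with h0 | h0
  · have : x = y := by rw [← hψx, ← hψ0, h0]
    simp [this, discAut_self]
  have hn0 : (‖τ‖ : ℂ) ≠ 0 := by simpa using h0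
  -- A disc in the bidisc with `φ 0 = y` and `φ ‖τ‖ = x`: a complex line through the origin
  -- transported by automorphisms of the factors.
  set φ : ℂ → ℂ × ℂ := fun t => ψ (t • (‖τ‖ : ℂ)⁻¹ • τ) with hφ
  have hφm : ∀ t : ℂ, ‖t‖ < 1 → ‖t • (‖τ‖ : ℂ)⁻¹ • τ‖ < 1 := fun t ht => by
    rw [norm_smul, norm_smul, norm_inv, Complex.norm_real, norm_norm,
      inv_mul_cancel₀ (norm_ne_zero_iff.2 h0), mul_one]
    exact ht
  have hy1' : ‖-y.1‖ < 1 := by simpa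
  have hy2' : ‖-y.2‖ < 1 := by simpa
  have hmaps : MapsTo φ (ball 0 1) (ball 0 1) := fun t ht => by
    have h3 := hφm t (mem_ball_zero_iff.1 ht)
    rw [mem_ball_zero_iff, Prod.norm_def]
    exact max_lt (norm_discAut_lt_one hy1' ((norm_fst_le _).trans_lt h3))
      (norm_discAut_lt_one hy2' ((norm_snd_le _).trans_lt h3))
  have hφd : DifferentiableOn ℂ φ (ball 0 1) := by
    refine DifferentiableOn.prodMk ?_ ?_
    · refine (differentiableOn_discAut hy1').comp (by fun_prop) fun t ht => ?_
      exact mem_ball_zero_iff.2 ((norm_fst_le _).trans_lt (hφm t (mem_ball_zero_iff.1 ht)))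
    · refine (differentiableOn_discAut hy2').comp (by fun_prop) fun t ht => ?_
      exact mem_ball_zero_iff.2 ((norm_snd_le _).trans_lt (hφm t (mem_ball_zero_iff.1 ht)))
  have e0 : φ 0 = y := by simp only [hφ, zero_smul, hψ0]
  have e1 : φ (‖τ‖ : ℂ) = x := by simp only [hφ, smul_inv_smul₀ hn0, hψx]
  have := norm_discAut_le_of_mapsTo (f := fun t => H (φ t)) (hH _ φ isOpen_ball hφd hmaps)
    (fun t ht => mem_closedBall_zero_iff.2 (hb _ (hmaps ht))) (z := (‖τ‖ : ℂ)) (w := 0)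
    (by simpa using hτ1) (by simp) (by simpa [e0] using hHy)
  rw [e0, e1] at this
  simpa [discAut] using this

/-! ### Real-linear isometries between maxima of moduli of functionals. -/

section LinearAlgebra

variable {V W : Type*} [NormedAddCommGroup V] [NormedSpace ℂ V]
  [NormedAddCommGroup W] [NormedSpace ℂ W]

/-- The squared moduli are real quadratic forms, so the parallelogram law spreads equality near one
point to the whole space. -/
lemma norm_eq_of_norm_eq_near {B₁ B₂ : V →L[ℝ] ℂ} {X₀ : V}
    (h : ∀ᶠ X in 𝓝 X₀, ‖B₁ X‖ = ‖B₂ X‖) (Y : V) : ‖B₁ Y‖ = ‖B₂ Y‖ := by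
  have h1 : Tendsto (fun t : ℝ => X₀ + t • Y) (𝓝 0) (𝓝 X₀) :=
    Continuous.tendsto' (by fun_prop) _ _ (by simp)
  have h2 : Tendsto (fun t : ℝ => X₀ - t • Y) (𝓝 0) (𝓝 X₀) :=
    Continuous.tendsto' (by fun_prop) _ _ (by simp)
  have h3 : ∀ᶠ t : ℝ in 𝓝[≠] 0, t ≠ 0 ∧ ‖B₁ (X₀ + t • Y)‖ = ‖B₂ (X₀ + t • Y)‖ ∧
      ‖B₁ (X₀ - t • Y)‖ = ‖B₂ (X₀ - t • Y)‖ :=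
    eventually_mem_nhdsWithin.and (nhdsWithin_le_nhds ((h1.eventually h).and (h2.eventually h)))
  obtain ⟨t, ht, e1, e2⟩ := h3.exists
  have e0 := h.self_of_nhds
  have p1 := parallelogram_law_with_norm ℝ (B₁ X₀) (B₁ (t • Y))
  have p2 := parallelogram_law_with_norm ℝ (B₂ X₀) (B₂ (t • Y))
  simp only [← map_add, ← map_sub] at p1 p2
  rw [e1, e2, e0, p2] at p1
  simp only [map_smul, norm_smul] at p1
  have ht' : 0 < ‖t‖ := norm_pos_iff.2 ht
  have h4 : ‖B₁ Y‖ ^ 2 = ‖B₂ Y‖ ^ 2 := by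
    have : ‖t‖ ^ 2 * (‖B₁ Y‖ ^ 2 - ‖B₂ Y‖ ^ 2) = 0 := by nlinarith
    rcases mul_eq_zero.1 this with h5 | h5
    · exact absurd h5 (by positivity)
    · linarith
  exact (sq_eq_sq₀ (norm_nonneg _) (norm_nonneg _)).1 h4

/-- If every `k` failed, each equality set would be closed with empty interior; by Baire, finitely
many of these cannot cover a neighbourhood. -/
lemma exists_norm_eq_of_near [BaireSpace V] {κ : Type*} [Finite κ] {B : V →L[ℝ] ℂ} {C : κ → V →L[ℝ] ℂ} {X₀ : V}
    (h : ∀ᶠ X in 𝓝 X₀, ∃ k, ‖C k X‖ = ‖B X‖) : ∃ k, ∀ Y, ‖C k Y‖ = ‖B Y‖ := by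
  by_contra! hcon
  have hopen : ∀ k, IsOpen {X | ‖C k X‖ ≠ ‖B X‖} := fun k =>
    isOpen_ne_fun (C k).continuous.norm B.continuous.norm
  have hdense : ∀ k, Dense {X | ‖C k X‖ ≠ ‖B X‖} := by
    intro k
    rw [← compl_compl {X | ‖C k X‖ ≠ ‖B X‖}, ← interior_eq_empty_iff_dense_compl,
      eq_empty_iff_forall_notMem]
    intro X hX
    obtain ⟨Y, hY⟩ := hcon k
    refine hY (norm_eq_of_norm_eq_near (X₀ := X) ?_ Y)
    filter_upwards [mem_interior_iff_mem_nhds.1 hX] with Z hZ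
    simpa using hZ
  have hfin : Dense (⋂ k, {X | ‖C k X‖ ≠ ‖B X‖}) := by
    have := Finite.to_countable (α := κ)
    exact dense_iInter_of_isOpen hopen hdense
  obtain ⟨X, hX, hX'⟩ := hfin.exists_mem_open isOpen_interior
    ⟨X₀, mem_interior_iff_mem_nhds.2 h⟩
  obtain ⟨k, hk⟩ := interior_subset hX'
  exact (mem_iInter.1 hX k) hk

/-- `T` vanishes on the kernel of `l`, so it factors through `l` as a real isometry of `ℂ`: a
rotation or a reflection. -/
lemma linear_or_antilinear_of_norm_eq {T : V →L[ℝ] ℂ} {l : V →L[ℂ] ℂ} (hl : l ≠ 0)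
    (h : ∀ X, ‖T X‖ = ‖l X‖) :
    ∃ σ : ℝ, (σ = 1 ∨ σ = -1) ∧ ∀ X, T (Complex.I • X) = σ * Complex.I * T X := by
  obtain ⟨e₀, he₀⟩ : ∃ e, l e ≠ 0 := by
    by_contra! h0
    exact hl (ContinuousLinearMap.ext h0)
  obtain ⟨e, hle⟩ : ∃ e, l e = 1 := ⟨(l e₀)⁻¹ • e₀, by simp [he₀]⟩
  set c := T e with hc
  set d := T (Complex.I • e) with hd
  have hT : ∀ X, T X = (l X).re * c + (l X).im * d := by
    intro X
    have h1 : T (X - ((l X).re • e + (l X).im • Complex.I • e)) = 0 := by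
      rw [← norm_eq_zero, h, norm_eq_zero]
      rw [map_sub, map_add, ← Complex.coe_smul, ← Complex.coe_smul, map_smul, map_smul, map_smul,
        hle]
      simp
    rw [map_sub, sub_eq_zero, map_add, T.map_smul, T.map_smul] at h1
    rw [h1]
    simp [hc, hd]
  have n1 : ‖c‖ ^ 2 = 1 := by rw [hc, h, hle]; simp
  have n2 : ‖d‖ ^ 2 = 1 := by rw [hd, h, map_smul, hle]; simp
  have n3 : ‖c + d‖ ^ 2 = 2 := by
    rw [hc, hd, ← map_add, h, map_add, map_smul, hle, Complex.sq_norm, Complex.normSq_apply]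
    norm_num
  rw [Complex.sq_norm, Complex.normSq_apply] at n1 n2 n3
  simp only [Complex.add_re, Complex.add_im] at n3
  have n4 : c.re * d.re + c.im * d.im = 0 := by linarith
  -- The determinant of the orthonormal pair `c`, `d`; its sign separates rotation from reflection.
  set σ : ℝ := c.re * d.im - c.im * d.re with hσ
  have hσ2 : σ = 1 ∨ σ = -1 := by
    rw [← sq_eq_one_iff]
    have : σ ^ 2 + (c.re * d.re + c.im * d.im) ^ 2 =
        (c.re * c.re + c.im * c.im) * (d.re * d.re + d.im * d.im) := by rw [hσ]; ring
    rw [n4, n1, n2] at this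
    linarith
  have hdc : d = σ * Complex.I * c := by
    apply Complex.ext
    · simp only [Complex.mul_re, Complex.mul_im, Complex.ofReal_re, Complex.ofReal_im,
        Complex.I_re, Complex.I_im]
      rw [hσ]
      linear_combination -d.re * n1 + c.re * n4
    · simp only [Complex.mul_re, Complex.mul_im, Complex.ofReal_re, Complex.ofReal_im,
        Complex.I_re, Complex.I_im]
      rw [hσ]
      linear_combination -d.im * n1 + c.im * n4
  have hσ1 : (σ : ℂ) ^ 2 = 1 := by
    rcases hσ2 with h | h <;> rw [h] <;> norm_num
  refine ⟨σ, hσ2, fun X => ?_⟩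
  rw [hT, hT, map_smul, hdc]
  simp only [smul_eq_mul, Complex.mul_re, Complex.mul_im, Complex.I_re, Complex.I_im]
  push_cast
  linear_combination (-(l X).im * c * (σ : ℂ) ^ 2) * Complex.I_sq + (l X).im * c * hσ1

/-- A nonzero common zero would span the kernel of `l₁`, making `l₂` a multiple of `l₁`; then
neither could dominate the other at different vectors. -/
lemma eq_zero_of_strictly_active (hV : Module.finrank ℂ V = 2) {l₁ l₂ : V →L[ℂ] ℂ} {X₁ X₂ Z : V}
    (h1 : ‖l₂ X₁‖ < ‖l₁ X₁‖) (h2 : ‖l₁ X₂‖ < ‖l₂ X₂‖) (hZ1 : l₁ Z = 0) (hZ2 : l₂ Z = 0) : Z = 0 := by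
  by_contra hZ
  have hX1 : l₁ X₁ ≠ 0 := norm_pos_iff.1 ((norm_nonneg _).trans_lt h1)
  have : FiniteDimensional ℂ V := FiniteDimensional.of_finrank_pos (by omega)
  have hr : LinearMap.range (l₁ : V →ₗ[ℂ] ℂ) = ⊤ := by
    rw [LinearMap.range_eq_top]
    exact LinearMap.surjective (f := (l₁ : V →ₗ[ℂ] ℂ)) fun h0 => hX1 (by
      simpa using LinearMap.congr_fun h0 X₁)
  have hk : Module.finrank ℂ (LinearMap.ker (l₁ : V →ₗ[ℂ] ℂ)) = 1 := by
    have := LinearMap.finrank_range_add_finrank_ker (l₁ : V →ₗ[ℂ] ℂ)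
    rw [hr, finrank_top, Module.finrank_self, hV] at this
    omega
  set Z' : LinearMap.ker (l₁ : V →ₗ[ℂ] ℂ) := ⟨Z, hZ1⟩ with hZ'
  have hZ'0 : Z' ≠ 0 := fun h => hZ (congrArg Subtype.val h)
  set b := l₁ X₂ / l₁ X₁ with hb
  have hm : l₁ (X₂ - b • X₁) = 0 := by
    rw [map_sub, map_smul, smul_eq_mul, hb, div_mul_cancel₀ _ hX1, sub_self]
  obtain ⟨a, ha⟩ := (finrank_eq_one_iff_of_nonzero' Z' hZ'0).1 hk ⟨X₂ - b • X₁, hm⟩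
  have ha' : a • Z = X₂ - b • X₁ := congrArg Subtype.val ha
  have e1 : l₁ X₂ = b * l₁ X₁ := by rw [hb, div_mul_cancel₀ _ hX1]
  have e2 : l₂ X₂ = b * l₂ X₁ := by
    have := congrArg l₂ ha'
    rw [map_smul, hZ2, smul_zero, map_sub, map_smul] at this
    exact (sub_eq_zero.1 this.symm)
  rw [e1, e2, norm_mul, norm_mul] at h2
  exact absurd h2 (not_lt.2 (by gcongr))

/-- Take a minimal family giving the same maximum: a member that never strictly dominated the others
could be dropped. -/
lemma exists_strictly_active {ι : Type*} [Finite ι] (l : ι → V →L[ℂ] ℂ) :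
    ∃ I : Finset ι, (∀ X k, ∃ i ∈ I, ‖l k X‖ ≤ ‖l i X‖) ∧
      ∀ i ∈ I, ∃ X, ∀ j ∈ I, j ≠ i → ‖l j X‖ < ‖l i X‖ := by
  classical
  have := Fintype.ofFinite ι
  obtain ⟨I, hI⟩ := exists_minimal_of_wellFoundedLT
    (fun I : Finset ι => ∀ X k, ∃ i ∈ I, ‖l k X‖ ≤ ‖l i X‖)
    ⟨Finset.univ, fun X k => ⟨k, Finset.mem_univ k, le_rfl⟩⟩
  refine ⟨I, hI.prop, fun i hi => ?_⟩
  have h1 : ¬ ∀ X k, ∃ j ∈ I.erase i, ‖l k X‖ ≤ ‖l j X‖ := fun h =>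
    (Finset.notMem_erase i I) (hI.2 h (Finset.erase_subset i I) hi)
  push Not at h1
  obtain ⟨X, k, hk⟩ := h1
  obtain ⟨i', hi', hle⟩ := hI.prop X k
  have : i' = i := by
    by_contra hne
    exact absurd (hk i' (Finset.mem_erase.2 ⟨hne, hi'⟩)) (not_lt.2 hle)
  subst this
  exact ⟨X, fun j hj hne => (hk j (Finset.mem_erase.2 ⟨hne, hj⟩)).trans_le hle⟩

/-- A real-linear map between complex planes that intertwines two norms given as maxima of moduli
of complex functionals is complex linear or antilinear, unless two functionals suffice. -/
theorem linear_or_antilinear_or_exists_pair (hV : Module.finrank ℂ V = 2)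
    (hW : Module.finrank ℂ W = 2) {ι κ : Type*} [Finite ι] [Finite κ] (l : ι → V →L[ℂ] ℂ)
    (m : κ → W →L[ℂ] ℂ) (A : V →L[ℝ] W) (h : ∀ X, ⨆ i, ‖l i X‖ₑ = ⨆ k, ‖m k (A X)‖ₑ)
    (hpos : ∀ X, (∀ i, l i X = 0) → X = 0) :
    (∃ σ : ℝ, (σ = 1 ∨ σ = -1) ∧ ∀ X, A (Complex.I • X) = ((σ : ℂ) * Complex.I) • A X) ∨
      ∃ i j, ∀ k X, ‖l k X‖ ≤ max ‖l i X‖ ‖l j X‖ := by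
  have hVf : FiniteDimensional ℂ V := FiniteDimensional.of_finrank_pos (by omega)
  have hWf : FiniteDimensional ℂ W := FiniteDimensional.of_finrank_pos (by omega)
  have hnt : Nontrivial V := Module.nontrivial_of_finrank_pos (R := ℂ) (by omega)
  have hVc : CompleteSpace V := FiniteDimensional.complete ℂ V
  obtain ⟨I, hI, hact⟩ := exists_strictly_active l
  obtain ⟨X₀, hX₀⟩ := exists_ne (0 : V)
  obtain ⟨k₀, hk₀⟩ : ∃ i, l i X₀ ≠ 0 := by
    by_contra! h0
    exact hX₀ (hpos X₀ h0)
  have hκ : Nonempty κ := by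
    by_contra hκ
    rw [not_nonempty_iff] at hκ
    have h1 := h X₀
    rw [ciSup_of_empty (f := fun k => ‖m k (A X₀)‖ₑ), iSup_eq_bot] at h1
    exact hk₀ (by simpa using h1 k₀)
  have hAinj : Function.Injective A := by
    rw [injective_iff_map_eq_zero]
    intro X hX
    refine hpos X fun i => ?_
    have h1 := h X
    simp only [hX, map_zero, enorm_zero, iSup_const] at h1
    simpa using (ENNReal.iSup_eq_zero.1 h1) i
  have hAsurj : Function.Surjective A := by
    refine (LinearMap.injective_iff_surjective_of_finrank_eq_finrank
      (f := (A : V →ₗ[ℝ] W)) ?_).1 hAinj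
    rw [finrank_real_of_complex, finrank_real_of_complex, hV, hW]
  rcases le_or_gt I.card 2 with hcard | hcard
  · right
    obtain ⟨i₀, hi₀, -⟩ := hI X₀ k₀
    obtain ⟨i, j, hij⟩ : ∃ i j, ∀ x ∈ I, x = i ∨ x = j := by
      classical
      have hc0 : 0 < I.card := Finset.card_pos.2 ⟨i₀, hi₀⟩
      interval_cases hc : I.card
      · obtain ⟨a, ha⟩ := Finset.card_eq_one.1 hc
        exact ⟨a, a, fun x hx => by simpa [ha] using hx⟩
      · obtain ⟨a, b, -, hab⟩ := Finset.card_eq_two.1 hc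
        exact ⟨a, b, fun x hx => by simpa [hab] using hx⟩
    refine ⟨i, j, fun k X => ?_⟩
    obtain ⟨x, hx, hle⟩ := hI X k
    rcases hij x hx with rfl | rfl
    · exact hle.trans (le_max_left _ _)
    · exact hle.trans (le_max_right _ _)
  · left
    have hmatch : ∀ i ∈ I, ∃ k, (∀ Y, ‖m k (A Y)‖ = ‖l i Y‖) ∧ ∃ σ : ℝ, (σ = 1 ∨ σ = -1) ∧
        ∀ X, m k (A (Complex.I • X)) = σ * Complex.I * m k (A X) := by
      intro i hi
      obtain ⟨X, hX⟩ := hact i hi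
      have hli : l i ≠ 0 := by
        rintro h0
        obtain ⟨a, ha, hai⟩ := Finset.exists_mem_ne (by omega : 1 < I.card) i
        have := hX a ha hai
        rw [h0] at this
        simp at this
        exact absurd this (not_lt.2 (norm_nonneg _))
      obtain ⟨k, hk⟩ : ∃ k, ∀ Y,
          ‖((m k).restrictScalars ℝ ∘L A) Y‖ = ‖(l i).restrictScalars ℝ Y‖ := by
        -- Near `X` the left norm is `‖l i Y‖`, and the finite supremum on the right is attained by
        -- some `k` depending on `Y`.
        refine exists_norm_eq_of_near (X₀ := X) ?_
        have h1 : ∀ᶠ Y in 𝓝 X, ∀ j ∈ I, j ≠ i → ‖l j Y‖ < ‖l i Y‖ := by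
          rw [Finset.eventually_all]
          intro j hj
          by_cases hji : j = i
          · exact Eventually.of_forall fun _ hne => absurd hji hne
          · filter_upwards [((l j).continuous.norm.tendsto X).eventually_lt
              ((l i).continuous.norm.tendsto X) (hX j hj hji)] with Y hY _ using hY
        filter_upwards [h1] with Y hY
        have hsup : ⨆ j, ‖l j Y‖ₑ = ‖l i Y‖ₑ := by
          refine le_antisymm (iSup_le fun j => ?_) (le_iSup (fun j => ‖l j Y‖ₑ) i)
          obtain ⟨x, hx, hle⟩ := hI Y j
          rw [enorm_le_iff_norm_le]
          rcases eq_or_ne x i with rfl | hne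
          · exact hle
          · exact hle.trans (hY x hx hne).le
        obtain ⟨k, hk⟩ := exists_eq_ciSup_of_finite (f := fun k => ‖m k (A Y)‖ₑ)
        refine ⟨k, ?_⟩
        rw [← h Y, hsup] at hk
        have := congrArg ENNReal.toReal hk
        simpa using this
      refine ⟨k, hk, ?_⟩
      exact linear_or_antilinear_of_norm_eq (T := (m k).restrictScalars ℝ ∘L A) hli hk
    have hconcl : ∀ i ∈ I, ∀ j ∈ I, i ≠ j → ∀ k k' (σ : ℝ), (σ = 1 ∨ σ = -1) →
        (∀ Y, ‖m k (A Y)‖ = ‖l i Y‖) → (∀ Y, ‖m k' (A Y)‖ = ‖l j Y‖) →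
        (∀ X, m k (A (Complex.I • X)) = σ * Complex.I * m k (A X)) →
        (∀ X, m k' (A (Complex.I • X)) = σ * Complex.I * m k' (A X)) →
        ∃ σ : ℝ, (σ = 1 ∨ σ = -1) ∧ ∀ X, A (Complex.I • X) = ((σ : ℂ) * Complex.I) • A X := by
      intro i hi j hj hij k k' σ hσ hk hk' hlk hlk'
      refine ⟨σ, hσ, fun X => ?_⟩
      -- The defect from (anti)linearity is pulled back to `Z`, which two active functionals
      -- annihilate.
      obtain ⟨Z, hZ⟩ := hAsurj (A (Complex.I • X) - ((σ : ℂ) * Complex.I) • A X)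
      obtain ⟨X₁, hX₁⟩ := hact i hi
      obtain ⟨X₂, hX₂⟩ := hact j hj
      have hZ0 : Z = 0 := by
        refine eq_zero_of_strictly_active hV (hX₁ j hj hij.symm) (hX₂ i hi hij) ?_ ?_
        · rw [← norm_eq_zero, ← hk, norm_eq_zero, hZ, map_sub, hlk, map_smul, smul_eq_mul, sub_self]
        · rw [← norm_eq_zero, ← hk', norm_eq_zero, hZ, map_sub, hlk', map_smul, smul_eq_mul,
            sub_self]
      rw [hZ0, map_zero] at hZ
      exact (sub_eq_zero.1 hZ.symm)
    obtain ⟨a, ha, b, hb, c, hc, hab, hac, hbc⟩ := Finset.two_lt_card.1 hcard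
    obtain ⟨ka, hka, σa, hσa, hla⟩ := hmatch a ha
    obtain ⟨kb, hkb, σb, hσb, hlb⟩ := hmatch b hb
    obtain ⟨kc, hkc, σc, hσc, hlc⟩ := hmatch c hc
    by_cases e1 : σa = σb
    · subst e1
      exact hconcl a ha b hb hab ka kb σa hσa hka hkb hla hlb
    by_cases e2 : σa = σc
    · subst e2
      exact hconcl a ha c hc hac ka kc σa hσa hka hkc hla hlc
    -- Pigeonhole: three signs, two values.
    have e3 : σb = σc := by
      rcases hσa with h1 | h1 <;> rcases hσb with h2 | h2 <;> rcases hσc with h3 | h3 <;>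
        first
        | exact absurd (h1.trans h2.symm) e1
        | exact absurd (h1.trans h3.symm) e2
        | exact h2.trans h3.symm
    subst e3
    exact hconcl b hb c hc hbc kb kc σb hσb hkb hkc hlb hlc

end LinearAlgebra

/-! ### Holomorphic discs and consequences of tautness. -/

section Discs

variable {E : Type*} [NormedAddCommGroup E] [NormedSpace ℂ E]
  {M : Type*} [TopologicalSpace M] [ChartedSpace E M]

lemma IsHolDisc.differentiableOn_comp {f : ℂ → M} (hf : IsHolDisc E f) {h : M → ℂ}
    (hh : MDifferentiable 𝓘(ℂ, E) 𝓘(ℂ, ℂ) h) : DifferentiableOn ℂ (fun s => h (f s)) (ball 0 1) :=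
  mdifferentiableOn_iff_differentiableOn.1 (hh.comp_mdifferentiableOn hf)

lemma IsHolDisc.mdifferentiableAt_zero {f : ℂ → M} (hf : IsHolDisc E f) :
    MDifferentiableAt 𝓘(ℂ, ℂ) 𝓘(ℂ, E) f 0 :=
  MDifferentiableOn.mdifferentiableAt hf (ball_mem_nhds 0 one_pos)

lemma IsHolDisc.deriv_comp {f : ℂ → M} (hf : IsHolDisc E f) {h : M → ℂ}
    (hh : MDifferentiable 𝓘(ℂ, E) 𝓘(ℂ, ℂ) h) :
    deriv (fun s => h (f s)) 0 = funDeriv E h (f 0) (discDeriv E f) := by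
  have h1 := mfderiv_comp (I := 𝓘(ℂ, ℂ)) (I' := 𝓘(ℂ, E)) (I'' := 𝓘(ℂ, ℂ)) (0 : ℂ) (hh (f 0))
    hf.mdifferentiableAt_zero
  rw [mfderiv_eq_fderiv] at h1
  rw [← fderiv_apply_one_eq_deriv]
  exact DFunLike.congr_fun h1 (1 : ℂ)

lemma IsHolDisc.continuousOn {f : ℂ → M} (hf : IsHolDisc E f) : ContinuousOn f (ball 0 1) :=
  MDifferentiableOn.continuousOn hf

variable (E) in
/-- The derivative of a function `h : M → ℂ` at `p`, as a functional on the model space. -/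
noncomputable def funDerivL (h : M → ℂ) (p : M) : E →L[ℂ] ℂ := mfderiv 𝓘(ℂ, E) 𝓘(ℂ, ℂ) h p

lemma hasFDerivAt_comp_extChartAt_symm {h : M → ℂ} {z : M}
    (hh : MDifferentiableAt 𝓘(ℂ, E) 𝓘(ℂ, ℂ) h z) :
    HasFDerivAt (fun x => h ((extChartAt 𝓘(ℂ, E) z).symm x))
      (funDerivL E h z) (extChartAt 𝓘(ℂ, E) z z) := by
  have h1 := hh.hasMFDerivAt.2
  simp only [mfld_simps] at h1
  exact hasFDerivWithinAt_univ.1 h1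

/-- A fixed centre rules out compact divergence, as seen on the compact sets `{0}` and `{z}`. -/
lemma IsTaut.exists_subseq [T1Space M] (h : IsTaut E M) {z : M} {f : ℕ → ℂ → M}
    (hf : ∀ n, IsHolDisc E (f n)) (hz : ∀ n, f n 0 = z) :
    ∃ φ : ℕ → ℕ, StrictMono φ ∧ ∃ g : ℂ → M, IsHolDisc E g ∧ g 0 = z ∧
      ∀ K ⊆ ball (0 : ℂ) 1, IsCompact K → ∀ U : Set M, IsOpen U → MapsTo g K U →
        ∀ᶠ n in atTop, MapsTo (f (φ n)) K U := by
  obtain ⟨φ, hφ, ⟨g, hg, hgc⟩ | hdiv⟩ := h f hf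
  · refine ⟨φ, hφ, g, hg, ?_, hgc⟩
    by_contra hne
    have := hgc {0} (by simp) isCompact_singleton {z}ᶜ isOpen_compl_singleton (by simpa using hne)
    obtain ⟨n, hn⟩ := this.exists
    exact hn rfl (hz _)
  · have := hdiv {0} (by simp) isCompact_singleton {z} isCompact_singleton
    obtain ⟨n, hn⟩ := this.exists
    simp [hz] at hn

variable [IsManifold 𝓘(ℂ, E) ω M]

lemma differentiableOn_comp_extChartAt_symm {h : M → ℂ}
    (hh : MDifferentiable 𝓘(ℂ, E) 𝓘(ℂ, ℂ) h) (z : M) :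
    DifferentiableOn ℂ (fun x => h ((extChartAt 𝓘(ℂ, E) z).symm x))
      (extChartAt 𝓘(ℂ, E) z).target := by
  have : IsManifold 𝓘(ℂ, E) 1 M := IsManifold.of_le (n := ω) le_top
  exact mdifferentiableOn_iff_differentiableOn.1
    (hh.comp_mdifferentiableOn (mdifferentiableOn_extChartAt_symm (x := z)))

/-- A zero would give discs centred at `z` with unbounded derivatives. A convergent subsequence maps
a fixed small disc into a bounded chart piece, where Cauchy's estimate bounds the derivatives. -/
lemma kobayashiMetric_pos [T1Space M] (h : IsTaut E M) (z : M) {X : E} (hX : X ≠ 0) :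
    0 < kobayashiMetric E z X := by
  have hman : IsManifold 𝓘(ℂ, E) 1 M := IsManifold.of_le (n := ω) le_top
  rw [pos_iff_ne_zero]
  intro h0
  have h1 : ∀ n : ℕ, ∃ f : ℂ → M, IsHolDisc E f ∧ f 0 = z ∧ ∃ α : ℂ, α • discDeriv E f = X ∧
      ‖α‖ₑ < ENNReal.ofReal (1 / ((n : ℝ) + 1)) := by
    intro n
    have : kobayashiMetric E z X < ENNReal.ofReal (1 / ((n : ℝ) + 1)) := by
      rw [h0]; exact ENNReal.ofReal_pos.2 (by positivity)
    simp only [kobayashiMetric, iInf_lt_iff] at this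
    obtain ⟨f, hf, hf0, α, hα, hlt⟩ := this
    exact ⟨f, hf, hf0, α, hα, hlt⟩
  choose f hf hf0 α hα hlt using h1
  obtain ⟨φ, hφ, g, hg, hg0, hgc⟩ := h.exists_subseq hf hf0
  set c := extChartAt 𝓘(ℂ, E) z with hc
  set U : Set M := c.source ∩ c ⁻¹' ball (c z) 1 with hU
  have hUo : IsOpen U := (continuousOn_extChartAt z).isOpen_inter_preimage
    (isOpen_extChartAt_source z) isOpen_ball
  have hzU : z ∈ U := ⟨mem_extChartAt_source z, mem_ball_self one_pos⟩
  have hgU : g ⁻¹' U ∈ 𝓝 (0 : ℂ) := by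
    have : ContinuousAt g 0 := hg.continuousOn.continuousAt (ball_mem_nhds 0 one_pos)
    exact this.preimage_mem_nhds (by rw [hg0]; exact hUo.mem_nhds hzU)
  obtain ⟨r, hr, hrU⟩ := Metric.mem_nhds_iff.1 (inter_mem hgU (ball_mem_nhds (0 : ℂ) one_pos))
  have hK : closedBall (0 : ℂ) (r / 2) ⊆ ball 0 r := closedBall_subset_ball (by linarith)
  have hev := hgc (closedBall 0 (r / 2)) (fun s hs => (hrU (hK hs)).2) (isCompact_closedBall _ _) U
    hUo (fun s hs => (hrU (hK hs)).1)
  have hXlim : Tendsto (fun n : ℕ => 1 / (((φ n : ℕ) : ℝ) + 1) * (1 / (r / 2))) atTop (𝓝 0) := by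
    simpa using ((tendsto_one_div_add_atTop_nhds_zero_nat (𝕜 := ℝ)).comp
      hφ.tendsto_atTop).mul_const (1 / (r / 2))
  have hlt' : ∀ᶠ n in atTop, 1 / (((φ n : ℕ) : ℝ) + 1) * (1 / (r / 2)) < ‖X‖ :=
    hXlim.eventually_lt_const (norm_pos_iff.2 hX)
  obtain ⟨n, hn, hnX⟩ := (hev.and hlt').exists
  set F := f (φ n) with hF
  have hd : DifferentiableOn ℂ (fun s => c (F s) - c z) (closedBall 0 (r / 2)) := by
    have h2 : MDifferentiableOn 𝓘(ℂ, ℂ) 𝓘(ℂ, E) F (closedBall 0 (r / 2)) :=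
      MDifferentiableOn.mono (hf _) fun s hs => (hrU (hK hs)).2
    have h3 : MDifferentiableOn 𝓘(ℂ, E) 𝓘(ℂ, E) c (chartAt E z).source :=
      mdifferentiableOn_extChartAt
    have h4 := h3.comp h2 fun s hs => by simpa [hc, mfld_simps] using (hn hs).1
    exact (mdifferentiableOn_iff_differentiableOn.1 h4).sub_const _
  have hder : ‖deriv (fun s => c (F s) - c z) 0‖ ≤ 1 / (r / 2) := by
    refine Complex.norm_deriv_le_of_forall_mem_sphere_norm_le (by linarith)
      (hd.diffContOnCl_ball subset_rfl) fun s hs => ?_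
    have := (hn (sphere_subset_closedBall hs)).2
    exact (mem_ball_iff_norm.1 this).le
  have hder' : deriv (fun s => c (F s) - c z) 0 = discDeriv E F := by
    have h2 := (hf (φ n)).mdifferentiableAt_zero.hasMFDerivAt.2
    simp only [mfld_simps] at h2
    rw [show f (φ n) 0 = z from hf0 _] at h2
    have h3 : HasFDerivAt (fun s => c (F s)) (mfderiv 𝓘(ℂ, ℂ) 𝓘(ℂ, E) F 0 : ℂ →L[ℂ] E) 0 :=
      hasFDerivWithinAt_univ.1 h2
    rw [← fderiv_apply_one_eq_deriv, (h3.sub_const (c z)).fderiv]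
    rfl
  rw [hder'] at hder
  have hαn := hlt (φ n)
  rw [← ofReal_norm, ENNReal.ofReal_lt_ofReal_iff (by positivity)] at hαn
  have : ‖X‖ = ‖α (φ n)‖ * ‖discDeriv E F‖ := by rw [← norm_smul, hα]
  rw [this] at hnX
  exact absurd hnX (not_lt.2 (by gcongr))

end Discs

/-! ### Holomorphic functions on normed spaces are of class `C¹`. -/

lemma continuousAt_fderiv_of_differentiableOn {E : Type*} [NormedAddCommGroup E] [NormedSpace ℂ E]
    {f : E → ℂ} {U : Set E} (hU : IsOpen U) (hf : DifferentiableOn ℂ f U) {a : E} (ha : a ∈ U) :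
    ContinuousAt (fderiv ℂ f) a := by
  have hca : ContinuousAt f a := (hf.differentiableAt (hU.mem_nhds ha)).continuousAt
  obtain ⟨R, hR, hRU⟩ := Metric.mem_nhds_iff.1
    (inter_mem (hU.mem_nhds ha) (hca.preimage_mem_nhds (ball_mem_nhds (f a) one_pos)))
  set r := R / 4 with hr
  have hr0 : 0 < r := by positivity
  have hdist : ∀ x ∈ ball a R, ∀ y ∈ ball a R, dist (f x) (f y) ≤ 2 := fun x hx y hy => by
    have h1 : dist (f x) (f a) < 1 := (hRU hx).2
    have h2 : dist (f y) (f a) < 1 := (hRU hy).2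
    linarith [dist_triangle_right (f x) (f y) (f a)]
  -- A Schwarz-type bound, uniform in `w`. Cauchy's estimate in `w = t • v` then turns it into a
  -- bound on the difference of derivatives at `x` and `a`.
  have hlip : ∀ x ∈ ball a r, ∀ w : E, ‖w‖ ≤ r →
      ‖f (x + w) - f (a + w)‖ ≤ 2 / (2 * r) * ‖x - a‖ := by
    intro x hx w hw
    have hsub : ball (a + w) (2 * r) ⊆ ball a R := fun y hy => by
      rw [mem_ball_iff_norm] at hy ⊢
      calc ‖y - a‖ = ‖(y - (a + w)) + w‖ := by congr 1; abel
        _ ≤ ‖y - (a + w)‖ + ‖w‖ := norm_add_le _ _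
        _ < R := by linarith
    have hmem : a + w ∈ ball a R := hsub (mem_ball_self (by linarith))
    have := Complex.dist_le_div_mul_dist_of_mapsTo_ball (f := f) (c := a + w) (z := x + w)
      (R₁ := 2 * r) (R₂ := 2) (hf.mono fun y hy => (hRU (hsub hy)).1)
      (fun y hy => hdist _ (hsub hy) _ hmem) (by
        rw [mem_ball_iff_norm] at hx ⊢
        rw [add_sub_add_right_eq_sub]; linarith)
    simpa [dist_eq_norm] using this
  rw [ContinuousAt, tendsto_iff_norm_sub_tendsto_zero]
  have hlim : Tendsto (fun x => 2 / (2 * r) * ‖x - a‖ / r) (𝓝 a) (𝓝 0) :=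
    Continuous.tendsto' (by fun_prop) _ _ (by simp)
  refine squeeze_zero' (Eventually.of_forall fun _ => norm_nonneg _) ?_ hlim
  filter_upwards [ball_mem_nhds a hr0] with x hx
  refine ContinuousLinearMap.opNorm_le_of_unit_norm (by positivity) fun v hv => ?_
  have hmem : ∀ y ∈ ball a r, ∀ t ∈ closedBall (0 : ℂ) r, y + t • v ∈ U := fun y hy t ht => by
    refine (hRU ?_).1
    rw [mem_ball_iff_norm] at hy ⊢
    rw [mem_closedBall_zero_iff] at ht
    calc ‖y + t • v - a‖ = ‖(y - a) + t • v‖ := by congr 1; abel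
      _ ≤ ‖y - a‖ + ‖t • v‖ := norm_add_le _ _
      _ < R := by rw [norm_smul, hv]; linarith
  have hd : ∀ y ∈ ball a r, ∀ t ∈ closedBall (0 : ℂ) r,
      HasDerivAt (fun t : ℂ => f (y + t • v)) (fderiv ℂ f (y + t • v) v) t := by
    intro y hy t ht
    have h1 := (hf.differentiableAt (hU.mem_nhds (hmem y hy t ht))).hasFDerivAt
    have h2 : HasDerivAt (fun t : ℂ => y + t • v) v t := by
      simpa using ((hasDerivAt_id t).smul_const v).const_add y
    exact h1.comp_hasDerivAt t h2
  have ha' : a ∈ ball a r := mem_ball_self hr0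
  have h0 : (0 : ℂ) ∈ closedBall (0 : ℂ) r := mem_closedBall_self hr0.le
  have hder : deriv (fun t : ℂ => f (x + t • v) - f (a + t • v)) 0 =
      (fderiv ℂ f x - fderiv ℂ f a) v := by
    have := ((hd x hx 0 h0).fun_sub (hd a ha' 0 h0)).deriv
    simpa using this
  rw [← hder]
  refine Complex.norm_deriv_le_of_forall_mem_sphere_norm_le hr0 ?_ fun t ht => ?_
  · refine DifferentiableOn.diffContOnCl_ball (U := closedBall 0 r) (fun t ht => ?_) subset_rfl
    exact ((hd x hx t ht).sub (hd a ha' t ht)).differentiableAt.differentiableWithinAt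
  · refine hlip x hx _ ?_
    rw [norm_smul, hv, mul_one, mem_sphere_zero_iff_norm.1 ht]

lemma contDiffAt_one_of_differentiableOn {E : Type*} [NormedAddCommGroup E] [NormedSpace ℂ E]
    {f : E → ℂ} {U : Set E} (hU : IsOpen U) (hf : DifferentiableOn ℂ f U) {a : E} (ha : a ∈ U) :
    ContDiffAt ℂ 1 f a :=
  contDiffAt_one_iff.2 ⟨fderiv ℂ f, U, hU.mem_nhds ha,
    fun _ hx => (continuousAt_fderiv_of_differentiableOn hU hf hx).continuousWithinAt,
    fun _ hx => (hf.differentiableAt (hU.mem_nhds hx)).hasFDerivAt⟩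

/-! ### Carathéodory metrics from finite universal sets, and extremal discs. -/

section

variable (E : Type*) [NormedAddCommGroup E] [NormedSpace ℂ E]
  {M : Type*} [TopologicalSpace M] [ChartedSpace E M]

/-- The derivative of `F : M → 𝔻` at `p`, measured by the Poincaré metric at `F p`. -/
noncomputable def poincareDeriv (F : M → ℂ) (p : M) : E →L[ℂ] ℂ :=
  ((1 - ‖F p‖ ^ 2 : ℝ) : ℂ)⁻¹ • funDerivL E F p

variable {E}

lemma IsHolToDisc.norm_lt_one {F : M → ℂ} (hF : IsHolToDisc E F) (x : M) : ‖F x‖ < 1 :=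
  mem_ball_zero_iff.1 (hF.2 x)

lemma IsHolToDisc.hasMFDerivAt_discAut {F : M → ℂ} (hF : IsHolToDisc E F) (p : M) :
    HasMFDerivAt 𝓘(ℂ, E) 𝓘(ℂ, ℂ) (fun x => discAut (F p) (F x)) p (poincareDeriv E F p) := by
  have h1 := (hasDerivAt_discAut_self (hF.norm_lt_one p)).hasFDerivAt.hasMFDerivAt
  refine (h1.comp p (hF.1 p).hasMFDerivAt).congr_mfderiv ?_
  refine ContinuousLinearMap.ext fun X => ?_
  exact mul_comm (funDerivL E F p X) _

lemma IsHolToDisc.discAut {F : M → ℂ} (hF : IsHolToDisc E F) (p : M) :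
    IsHolToDisc E (fun x => discAut (F p) (F x)) := by
  refine ⟨fun x => ?_, fun x => mem_ball_zero_iff.2
    (norm_discAut_lt_one (hF.norm_lt_one p) (hF.norm_lt_one x))⟩
  have h1 := (hasDerivAt_discAut (one_sub_conj_mul_ne_zero (hF.norm_lt_one p)
    (hF.norm_lt_one x).le)).differentiableAt.mdifferentiableAt
  exact h1.comp x (hF.1 x)

lemma IsHolToDisc.funDeriv_discAut {F : M → ℂ} (hF : IsHolToDisc E F) (p : M) (X : E) :
    funDeriv E (fun x => _root_.discAut (F p) (F x)) p X = poincareDeriv E F p X :=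
  DFunLike.congr_fun (hF.hasMFDerivAt_discAut p).mfderiv X

lemma IsCaratheodoryUniversal.exists_norm_discAut_le {S : Set (M → ℂ)}
    (hS : IsCaratheodoryUniversal E S) (hfin : S.Finite) (hne : S.Nonempty) {F : M → ℂ}
    (hF : IsHolToDisc E F) (z w : M) :
    ∃ G ∈ S, ‖discAut (F w) (F z)‖ ≤ ‖discAut (G w) (G z)‖ := by
  have h1 : ENNReal.ofReal (poincareDist (F z) (F w)) ≤
      ⨆ G : S, ENNReal.ofReal (poincareDist (G.1 z) (G.1 w)) := by
    rw [iSup_subtype'' S fun G => ENNReal.ofReal (poincareDist (G z) (G w)), ← hS.2]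
    exact le_iSup₂ (f := fun F (_ : IsHolToDisc E F) => ENNReal.ofReal (poincareDist (F z) (F w)))
      F hF
  have := hfin.to_subtype
  have := hne.to_subtype
  obtain ⟨G, hG⟩ := exists_eq_ciSup_of_finite
    (f := fun G : S => ENNReal.ofReal (poincareDist (G.1 z) (G.1 w)))
  rw [← hG, ENNReal.ofReal_le_ofReal_iff (poincareDist_nonneg _ _)] at h1
  have hG' := hS.1 G.1 G.2
  exact ⟨G.1, G.2, (poincareDist_le_iff (hF.norm_lt_one z) (hF.norm_lt_one w)
    (hG'.norm_lt_one z) (hG'.norm_lt_one w)).1 h1⟩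

/-- The infinitesimal form of universality: a function with a larger derivative than all of `S` at
`p` would also separate `p` from a nearby point better than all of `S`. -/
lemma caratheodoryMetric_eq_iSup {S : Set (M → ℂ)} (hS : IsCaratheodoryUniversal E S)
    (hfin : S.Finite) (hne : S.Nonempty) (p : M) (X : E) :
    caratheodoryMetric E p X = ⨆ F : S, ‖poincareDeriv E F.1 p X‖ₑ := by
  refine le_antisymm ?_ ?_
  · refine iSup_le fun F => iSup_le fun hF => iSup_le fun hFp => ?_
    by_contra! hlt
    set c := extChartAt 𝓘(ℂ, E) p with hc
    have hcurve : ∀ h : M → ℂ, MDifferentiableAt 𝓘(ℂ, E) 𝓘(ℂ, ℂ) h p → h p = 0 →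
        Tendsto (fun t : ℂ => ‖t⁻¹ • h (c.symm (c p + t • X))‖) (𝓝[≠] 0)
          (𝓝 ‖funDeriv E h p X‖) := by
      intro h hh hp
      have h1 := hasFDerivAt_comp_extChartAt_symm hh
      have h2 : HasDerivAt (fun t : ℂ => c p + t • X) X 0 := by
        simpa using ((hasDerivAt_id (0 : ℂ)).smul_const X).const_add (c p)
      have h1' : HasFDerivAt (fun x => h (c.symm x)) (funDerivL E h p) (c p + (0 : ℂ) • X) := by
        rwa [zero_smul, add_zero]
      have h3 := h1'.comp_hasDerivAt (0 : ℂ) h2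
      replace h3 : HasDerivAt (fun t : ℂ => h (c.symm (c p + t • X))) (funDeriv E h p X) 0 := h3
      have h4 := h3.tendsto_slope_zero.norm
      simpa [hc, hp] using h4
    -- Finiteness of `S` provides one `t` that works for every `G`.
    have hall : ∀ᶠ t : ℂ in 𝓝[≠] 0, ∀ G ∈ S,
        ‖t⁻¹ • discAut (G p) (G (c.symm (c p + t • X)))‖ < ‖t⁻¹ • F (c.symm (c p + t • X))‖ := by
      rw [eventually_all_finite hfin]
      intro G hG
      have hG' := hS.1 G hG
      refine (hcurve _ ((hG'.discAut p).1 p) (discAut_self _)).eventually_lt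
        (hcurve F (hF.1 p) hFp) ?_
      rw [hG'.funDeriv_discAut p X, ← lt_iff_lt_of_le_iff_le enorm_le_iff_norm_le]
      exact (le_iSup (fun F : S => ‖poincareDeriv E F.1 p X‖ₑ) ⟨G, hG⟩).trans_lt hlt
    obtain ⟨t, ht⟩ := hall.exists
    obtain ⟨G, hG, hle⟩ := hS.exists_norm_discAut_le hfin hne hF (c.symm (c p + t • X)) p
    have h5 := ht G hG
    rw [norm_smul, norm_smul] at h5
    rw [hFp] at hle
    have h6 : ‖discAut 0 (F (c.symm (c p + t • X)))‖ = ‖F (c.symm (c p + t • X))‖ := by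
      simp [discAut]
    rw [h6] at hle
    exact absurd h5 (not_lt.2 (by gcongr))
  · refine iSup_le fun F => ?_
    have hF := hS.1 F.1 F.2
    rw [← hF.funDeriv_discAut p X]
    exact le_iSup₂_of_le _ (hF.discAut p) (le_iSup_of_le (discAut_self _) le_rfl)

/-- A limit of almost extremal discs. Each admissible `h` composed with them has derivative at the
origin tending to modulus one, so by stability in the Schwarz lemma it becomes linear in the limit.
The same disc and the same `α` serve all such `h`. -/
lemma IsTaut.exists_extremal_disc [T1Space M] (ht : IsTaut E M) {z : M} {X : E}
    (hk : kobayashiMetric E z X = 1) {h₀ : M → ℂ} (hh₀ : IsHolToDisc E h₀) (hz₀ : h₀ z = 0)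
    (hX₀ : ‖funDeriv E h₀ z X‖ = 1) :
    ∃ f : ℂ → M, IsHolDisc E f ∧ f 0 = z ∧ ∃ α : ℂ, ‖α‖ = 1 ∧ ∀ h : M → ℂ, IsHolToDisc E h →
      h z = 0 → ‖funDeriv E h z X‖ = 1 → ∀ s ∈ ball (0 : ℂ) 1,
        h (f s) = α * funDeriv E h z X * s := by
  have h1 : ∀ n : ℕ, ∃ f : ℂ → M, IsHolDisc E f ∧ f 0 = z ∧ ∃ α : ℂ, α • discDeriv E f = X ∧
      ‖α‖ₑ < ENNReal.ofReal (1 + 1 / ((n : ℝ) + 1)) := by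
    intro n
    have : kobayashiMetric E z X < ENNReal.ofReal (1 + 1 / ((n : ℝ) + 1)) := by
      rw [hk, ENNReal.one_lt_ofReal]
      have : 0 < 1 / ((n : ℝ) + 1) := by positivity
      linarith
    simp only [kobayashiMetric, iInf_lt_iff] at this
    obtain ⟨f, hf, hf0, α, hα, hlt⟩ := this
    exact ⟨f, hf, hf0, α, hα, hlt⟩
  choose f hf hf0 α hα hlt using h1
  have hmaps : ∀ h : M → ℂ, IsHolToDisc E h → ∀ n, MapsTo (fun s => h (f n s)) (ball 0 1)
      (closedBall 0 1) := fun h hh n s _ => ball_subset_closedBall (hh.2 _)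
  have hder : ∀ h : M → ℂ, IsHolToDisc E h → ∀ n,
      funDeriv E h z X = α n * deriv (fun s => h (f n s)) 0 := by
    intro h hh n
    rw [(hf n).deriv_comp hh.1, hf0, ← hα n]
    exact map_smul (mfderiv 𝓘(ℂ, E) 𝓘(ℂ, ℂ) h z) (α n) _
  -- Schwarz applied to `h₀` on the discs; with `hα2` this forces `‖α n‖` to tend to one.
  have hα1 : ∀ n, 1 ≤ ‖α n‖ := by
    intro n
    have hd : ‖deriv (fun s => h₀ (f n s)) 0‖ ≤ 1 := by
      refine Complex.norm_deriv_le_one_of_mapsTo_ball ((hf n).differentiableOn_comp hh₀.1) ?_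
        one_pos
      simp only [hf0, hz₀]
      exact hmaps h₀ hh₀ n
    rw [hder h₀ hh₀ n, norm_mul] at hX₀
    nlinarith [norm_nonneg (α n)]
  have hα2 : ∀ n, ‖α n‖ < 1 + 1 / ((n : ℝ) + 1) := by
    intro n
    have := hlt n
    rwa [← ofReal_norm, ENNReal.ofReal_lt_ofReal_iff (by positivity)] at this
  have hαlim : Tendsto (fun n => ‖α n‖) atTop (𝓝 1) := by
    refine tendsto_of_tendsto_of_tendsto_of_le_of_le tendsto_const_nhds ?_ hα1
      (fun n => (hα2 n).le)
    simpa using (tendsto_one_div_add_atTop_nhds_zero_nat (𝕜 := ℝ)).const_add 1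
  obtain ⟨β, -, ψ, hψ, hβ⟩ := (isCompact_closedBall (0 : ℂ) 2).tendsto_subseq (x := α) fun n => by
    rw [mem_closedBall_zero_iff]
    have : 1 / ((n : ℝ) + 1) ≤ 1 := by
      rw [div_le_one (by positivity)]; linarith [(Nat.cast_nonneg n : (0 : ℝ) ≤ n)]
    linarith [hα2 n]
  have hβ1 : ‖β‖ = 1 := tendsto_nhds_unique hβ.norm (hαlim.comp hψ.tendsto_atTop)
  have hβ0 : β ≠ 0 := by rintro rfl; simp at hβ1
  obtain ⟨φ, hφ, g, hg, hg0, hgc⟩ := ht.exists_subseq (f := fun n => f (ψ n)) (fun n => hf _)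
    fun n => hf0 _
  refine ⟨g, hg, hg0, β⁻¹, by rw [norm_inv, hβ1, inv_one], fun h hh hz hX s hs => ?_⟩
  have hpt : Tendsto (fun n => f (ψ (φ n)) s) atTop (𝓝 (g s)) := by
    refine tendsto_nhds.2 fun U hU hgU => ?_
    filter_upwards [hgc {s} (by simpa using hs) isCompact_singleton U hU (by simpa using hgU)]
      with n hn using hn rfl
  have hl1 : Tendsto (fun n => h (f (ψ (φ n)) s)) atTop (𝓝 (h (g s))) :=
    (hh.1.continuous.tendsto _).comp hpt
  refine tendsto_nhds_unique hl1 ?_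
  refine tendsto_of_schwarz (f := fun n s => h (f (ψ (φ n)) s))
    (fun n => (hf _).differentiableOn_comp hh.1) (fun n => hmaps h hh _)
    (fun n => by simp [hf0, hz]) (by rw [norm_mul, norm_inv, hβ1, hX, inv_one, one_mul]) ?_
    (mem_ball_zero_iff.1 hs)
  have : ∀ n, deriv (fun s => h (f (ψ (φ n)) s)) 0 = (α (ψ (φ n)))⁻¹ * funDeriv E h z X := by
    intro n
    have hne : α (ψ (φ n)) ≠ 0 := by
      intro h0
      have := hα1 (ψ (φ n))
      rw [h0, norm_zero] at this
      linarith
    rw [hder h hh (ψ (φ n)), inv_mul_cancel_left₀ hne]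
  simp only [this]
  exact ((hβ.comp hφ.tendsto_atTop).inv₀ hβ0).mul_const _

end

/-! ### Two functions that determine the metric at one point. -/

section

variable {E : Type*} [NormedAddCommGroup E] [NormedSpace ℂ E]
  {M : Type*} [TopologicalSpace M] [ChartedSpace E M]

lemma isCaratheodoryUniversal_pair {F₁ F₂ : M → ℂ} (hF₁ : IsHolToDisc E F₁)
    (hF₂ : IsHolToDisc E F₂) (h : ∀ F : M → ℂ, IsHolToDisc E F → ∀ p q : M,
      ‖discAut (F q) (F p)‖ ≤ max ‖discAut (F₁ q) (F₁ p)‖ ‖discAut (F₂ q) (F₂ p)‖) :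
    IsCaratheodoryUniversal E {F₁, F₂} := by
  have hmem : ∀ F ∈ ({F₁, F₂} : Set (M → ℂ)), IsHolToDisc E F := by
    rintro F (rfl | rfl)
    exacts [hF₁, hF₂]
  refine ⟨hmem, fun z w => le_antisymm (iSup₂_le fun F hF => ?_) (iSup₂_le fun F hF => ?_)⟩
  · obtain ⟨G, hG, hle⟩ : ∃ G ∈ ({F₁, F₂} : Set (M → ℂ)),
        ‖discAut (F w) (F z)‖ ≤ ‖discAut (G w) (G z)‖ := by
      rcases le_max_iff.1 (h F hF z w) with h1 | h1
      · exact ⟨F₁, by simp, h1⟩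
      · exact ⟨F₂, by simp, h1⟩
    have hG' := hmem G hG
    refine le_iSup₂_of_le G hG (ENNReal.ofReal_le_ofReal ?_)
    exact (poincareDist_le_iff (hF.norm_lt_one z) (hF.norm_lt_one w) (hG'.norm_lt_one z)
      (hG'.norm_lt_one w)).2 hle
  · exact le_iSup₂ (f := fun F (_ : IsHolToDisc E F) => ENNReal.ofReal (poincareDist (F z) (F w)))
      F (hmem F hF)

variable [IsManifold 𝓘(ℂ, E) ω M]

/-- The **identity theorem** for a holomorphic function and a function of two holomorphic functions
that is holomorphic along discs. -/
lemma eq_of_eventuallyEq_of_holAlongDiscs [ConnectedSpace M] {F h₁ h₂ : M → ℂ}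
    (hF : MDifferentiable 𝓘(ℂ, E) 𝓘(ℂ, ℂ) F) (hh₁ : MDifferentiable 𝓘(ℂ, E) 𝓘(ℂ, ℂ) h₁)
    (hh₂ : MDifferentiable 𝓘(ℂ, E) 𝓘(ℂ, ℂ) h₂) {B : Set (ℂ × ℂ)} (hB : ∀ x, (h₁ x, h₂ x) ∈ B)
    {H : ℂ × ℂ → ℂ} (hH : HolAlongDiscs H B) {z : M}
    (hz : ∀ᶠ x in 𝓝 z, F x = H (h₁ x, h₂ x)) (x : M) : F x = H (h₁ x, h₂ x) := by
  set Z : Set M := {p | ∀ᶠ x in 𝓝 p, F x = H (h₁ x, h₂ x)} with hZ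
  have hopen : IsOpen Z := isOpen_setOfPred_eventually_nhds
  have hclosed : IsClosed Z := by
    refine isClosed_of_closure_subset fun p hp => ?_
    set c := extChartAt 𝓘(ℂ, E) p with hc
    obtain ⟨δ, hδ, hball⟩ := Metric.isOpen_iff.1 (isOpen_extChartAt_target (I := 𝓘(ℂ, E)) p) (c p)
      (mem_extChartAt_target p)
    set U : Set M := c.source ∩ c ⁻¹' ball (c p) δ with hU
    have hUo : IsOpen U := (continuousOn_extChartAt p).isOpen_inter_preimage
      (isOpen_extChartAt_source p) isOpen_ball
    have hpU : p ∈ U := ⟨mem_extChartAt_source p, mem_ball_self hδ⟩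
    obtain ⟨q, hqU, hqZ⟩ := mem_closure_iff.1 hp U hUo hpU
    filter_upwards [hUo.mem_nhds hpU] with y hy
    -- `H` is holomorphic only along discs, so the identity is propagated from `q` to `y` along a
    -- complex line in the chart, by the one-variable identity theorem on the convex set `T`.
    set ℓ : ℂ → E := fun t => c q + t • (c y - c q) with hℓ
    set T : Set ℂ := ℓ ⁻¹' ball (c p) δ with hT
    have hℓc : Continuous ℓ := by fun_prop
    have hℓd : Differentiable ℂ ℓ := by fun_prop
    have hTo : IsOpen T := isOpen_ball.preimage hℓc
    have hTconv : Convex ℝ T := by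
      intro t ht s hs a b ha hb hab
      have e : ℓ (a • t + b • s) = a • ℓ t + b • ℓ s := by
        have hab' : (a : ℂ) + b = 1 := by exact_mod_cast hab
        simp only [hℓ, ← Complex.coe_smul, smul_eq_mul, smul_add, add_smul, smul_smul]
        nth_rw 1 [← one_smul ℂ (c q), ← hab', add_smul]
        abel
      rw [hT, mem_preimage, e]
      exact convex_ball _ _ ht hs ha hb hab
    have hmaps : MapsTo ℓ T c.target := fun t ht => hball ht
    have hd : ∀ h : M → ℂ, MDifferentiable 𝓘(ℂ, E) 𝓘(ℂ, ℂ) h →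
        DifferentiableOn ℂ (fun t => h (c.symm (ℓ t))) T := fun h hh =>
      (differentiableOn_comp_extChartAt_symm hh p).comp hℓd.differentiableOn hmaps
    have h0 : ℓ 0 = c q := by simp [hℓ]
    have h1 : ℓ 1 = c y := by simp [hℓ]
    have h0T : (0 : ℂ) ∈ T := by rw [hT, mem_preimage, h0]; exact hqU.2
    have h1T : (1 : ℂ) ∈ T := by rw [hT, mem_preimage, h1]; exact hy.2
    have hcont : Tendsto (fun t => c.symm (ℓ t)) (𝓝 0) (𝓝 q) := by
      have h2 : ContinuousAt c.symm (ℓ 0) :=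
        (continuousOn_extChartAt_symm p).continuousAt
          ((isOpen_extChartAt_target p).mem_nhds (hmaps h0T))
      have h3 := ContinuousAt.comp (g := c.symm) h2 hℓc.continuousAt
      have h4 : c.symm (ℓ 0) = q := by rw [h0]; exact c.left_inv hqU.1
      rw [← h4]
      exact h3
    have := AnalyticOnNhd.eqOn_of_preconnected_of_eventuallyEq (𝕜 := ℂ)
      ((hd F hF).analyticOnNhd hTo)
      ((hH T (fun t => (h₁ (c.symm (ℓ t)), h₂ (c.symm (ℓ t)))) hTo ((hd h₁ hh₁).prodMk (hd h₂ hh₂))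
        fun t _ => hB _).analyticOnNhd hTo) hTconv.isPreconnected h0T (hcont.eventually hqZ) h1T
    simpa only [h1, c.left_inv hy.1] using this
  have := (IsClopen.eq_univ ⟨hclosed, hopen⟩ ⟨z, hz⟩)
  have hx : x ∈ Z := this ▸ mem_univ x
  exact hx.self_of_nhds

/-- If at one point the Carathéodory metric is determined by two functions, then so is the
Carathéodory distance everywhere. -/
theorem norm_discAut_le_max_of_metric_eq_max [T1Space M] [ConnectedSpace M]
    (hE : Module.finrank ℂ E = 2) (ht : IsTaut E M)
    (hm : ∀ (p : M) (X : E), kobayashiMetric E p X = caratheodoryMetric E p X) {z : M}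
    {F₁ F₂ : M → ℂ} (hF₁ : IsHolToDisc E F₁) (hF₂ : IsHolToDisc E F₂)
    (hmax : ∀ X : E, caratheodoryMetric E z X =
      max ‖poincareDeriv E F₁ z X‖ₑ ‖poincareDeriv E F₂ z X‖ₑ)
    {F : M → ℂ} (hF : IsHolToDisc E F) (p q : M) :
    ‖discAut (F q) (F p)‖ ≤ max ‖discAut (F₁ q) (F₁ p)‖ ‖discAut (F₂ q) (F₂ p)‖ := by
  have hfd : FiniteDimensional ℂ E := FiniteDimensional.of_finrank_pos (by omega)
  have hcomp : CompleteSpace E := FiniteDimensional.complete ℂ E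
  set h₁ : M → ℂ := fun x => discAut (F₁ z) (F₁ x) with hh₁
  set h₂ : M → ℂ := fun x => discAut (F₂ z) (F₂ x) with hh₂
  have hol₁ : IsHolToDisc E h₁ := hF₁.discAut z
  have hol₂ : IsHolToDisc E h₂ := hF₂.discAut z
  have hz₁ : h₁ z = 0 := discAut_self _
  have hz₂ : h₂ z = 0 := discAut_self _
  have hd₁ : ∀ X, funDeriv E h₁ z X = poincareDeriv E F₁ z X := hF₁.funDeriv_discAut z
  have hd₂ : ∀ X, funDeriv E h₂ z X = poincareDeriv E F₂ z X := hF₂.funDeriv_discAut z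
  set c := extChartAt 𝓘(ℂ, E) z with hc
  set L : E →L[ℂ] ℂ × ℂ := (funDerivL E h₁ z).prod (funDerivL E h₂ z) with hL
  -- A common zero of the two derivatives would have Kobayashi length zero. In dimension two, `(h₁,
  -- h₂)` is therefore a local coordinate system.
  have hLinj : Function.Injective L := by
    rw [injective_iff_map_eq_zero]
    intro X hX
    by_contra hne
    have hpos := kobayashiMetric_pos ht z hne
    have e1 : funDeriv E h₁ z X = 0 := congrArg Prod.fst hX
    have e2 : funDeriv E h₂ z X = 0 := congrArg Prod.snd hX
    rw [hm, hmax, ← hd₁, ← hd₂, e1, e2] at hpos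
    simp at hpos
  set L' : E ≃L[ℂ] ℂ × ℂ := (LinearEquiv.ofInjectiveOfFinrankEq (L : E →ₗ[ℂ] ℂ × ℂ) hLinj
    (by simp [hE])).toContinuousLinearEquiv with hL'
  have hLL' : (L' : E →L[ℂ] ℂ × ℂ) = L := rfl
  set Φ : E → ℂ × ℂ := fun x => (h₁ (c.symm x), h₂ (c.symm x)) with hΦ
  have hto : IsOpen c.target := isOpen_extChartAt_target z
  have hct : c z ∈ c.target := mem_extChartAt_target z
  have hΦs : ContDiffAt ℂ 1 Φ (c z) :=
    (contDiffAt_one_of_differentiableOn hto (differentiableOn_comp_extChartAt_symm hol₁.1 z)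
      hct).prodMk
    (contDiffAt_one_of_differentiableOn hto (differentiableOn_comp_extChartAt_symm hol₂.1 z) hct)
  have hΦd : HasFDerivAt Φ (L' : E →L[ℂ] ℂ × ℂ) (c z) :=
    (hasFDerivAt_comp_extChartAt_symm (hol₁.1 z)).prodMk
      (hasFDerivAt_comp_extChartAt_symm (hol₂.1 z))
  have hΦz : Φ (c z) = 0 := by
    have : c.symm (c z) = z := c.left_inv (mem_extChartAt_source z)
    simp only [hΦ, this, hz₁, hz₂]
    rfl
  set Ψ := hΦs.localInverse hΦd one_ne_zero with hΨ
  have hΨs : ContDiffAt ℂ 1 Ψ 0 := by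
    have := hΦs.to_localInverse hΦd one_ne_zero
    rwa [hΦz] at this
  have hΨ0 : Ψ 0 = c z := by
    have := hΦs.localInverse_apply_image hΦd one_ne_zero
    rwa [hΦz] at this
  have hleft : ∀ᶠ x in 𝓝 (c z), Ψ (Φ x) = x :=
    (hΦs.hasStrictFDerivAt' hΦd one_ne_zero).eventually_left_inverse
  have hleftM : ∀ᶠ x in 𝓝 z, c.symm (Ψ (h₁ x, h₂ x)) = x := by
    filter_upwards [(continuousAt_extChartAt (I := 𝓘(ℂ, E)) z).eventually hleft,
      extChartAt_source_mem_nhds (I := 𝓘(ℂ, E)) z] with x hx hxs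
    have e : c.symm (c x) = x := c.left_inv hxs
    simp only [hΦ] at hx
    rw [e] at hx
    rw [hx, e]
  set G : ℂ × ℂ → ℂ := fun y => F (c.symm (Ψ y)) with hG
  obtain ⟨ε, hε, hGd⟩ : ∃ ε > 0, DifferentiableOn ℂ G (ball 0 ε) := by
    have e1 : ∀ᶠ y in 𝓝 (0 : ℂ × ℂ), DifferentiableAt ℂ Ψ y := by
      filter_upwards [hΨs.eventually (by simp)] with y hy using hy.differentiableAt one_ne_zero
    have e2 : ∀ᶠ y in 𝓝 (0 : ℂ × ℂ), Ψ y ∈ c.target :=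
      hΨs.continuousAt.eventually (by rw [hΨ0]; exact hto.mem_nhds hct)
    obtain ⟨ε, hε, hs⟩ := Metric.eventually_nhds_iff_ball.1 (e1.and e2)
    refine ⟨ε, hε, (differentiableOn_comp_extChartAt_symm hF.1 z).comp
      (fun y hy => (hs y hy).1.differentiableWithinAt) fun y hy => (hs y hy).2⟩
  obtain ⟨H, hHG, hHd, hHb⟩ := exists_bidisc_extension hε hGd
    (fun y _ => (hF.norm_lt_one _).le) (by
      intro u v hu hv
      -- This vector has unit length and both functionals attain modulus one on it, so a single
      -- extremal disc is linear in both coordinates.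
      set X : E := L'.symm (u, v) with hX
      have hLX : L X = (u, v) := by rw [← hLL']; exact L'.apply_symm_apply _
      have e1 : funDeriv E h₁ z X = u := congrArg Prod.fst hLX
      have e2 : funDeriv E h₂ z X = v := congrArg Prod.snd hLX
      have hk : kobayashiMetric E z X = 1 := by
        rw [hm, hmax, ← hd₁, ← hd₂, e1, e2, ← ofReal_norm, ← ofReal_norm, hu, hv]
        simp
      obtain ⟨f, hf, hf0, α, hα, hfh⟩ := ht.exists_extremal_disc hk hol₁ hz₁ (by rw [e1, hu])
      have hα0 : α ≠ 0 := by rintro rfl; simp at hα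
      have hαm : MapsTo (fun s => α⁻¹ * s) (ball (0 : ℂ) 1) (ball 0 1) := fun s hs => by
        simpa [hα] using hs
      -- Rotating the parameter by `α⁻¹` turns the extremal disc into `s ↦ s • (u, v)` in the
      -- coordinates `(h₁, h₂)`.
      refine ⟨fun s => F (f (α⁻¹ * s)), ?_, fun s hs => (hF.norm_lt_one _).le, ?_⟩
      · exact (hf.differentiableOn_comp hF.1).comp (by fun_prop) hαm
      · have hfc : Tendsto (fun s => f (α⁻¹ * s)) (𝓝 0) (𝓝 z) := by
          have h3 : ContinuousAt f (α⁻¹ * 0) := by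
            rw [mul_zero]
            exact hf.continuousOn.continuousAt (ball_mem_nhds 0 one_pos)
          have h4 : f (α⁻¹ * 0) = z := by rw [mul_zero, hf0]
          rw [← h4]
          exact ContinuousAt.comp (f := fun s => α⁻¹ * s) h3 (by fun_prop)
        filter_upwards [hfc.eventually hleftM, ball_mem_nhds (0 : ℂ) one_pos] with s hs hsb
        have a1 := hfh h₁ hol₁ hz₁ (by rw [e1, hu]) _ (hαm hsb)
        have a2 := hfh h₂ hol₂ hz₂ (by rw [e2, hv]) _ (hαm hsb)
        rw [e1] at a1
        rw [e2] at a2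
        have a3 : s • (u, v) = (h₁ (f (α⁻¹ * s)), h₂ (f (α⁻¹ * s))) := by
          rw [a1, a2]
          ext <;> simp <;> field_simp
        rw [a3]
        exact congrArg F hs.symm)
  have hB : ∀ x, (h₁ x, h₂ x) ∈ ball (0 : ℂ × ℂ) 1 := fun x => by
    rw [mem_ball_zero_iff, Prod.norm_def]
    exact max_lt (hol₁.norm_lt_one x) (hol₂.norm_lt_one x)
  have hident : ∀ x, F x = H (h₁ x, h₂ x) := by
    refine eq_of_eventuallyEq_of_holAlongDiscs hF.1 hol₁.1 hol₂.1 hB hHd (z := z) ?_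
    have hlim : Tendsto (fun x => (h₁ x, h₂ x)) (𝓝 z) (𝓝 0) := by
      have := (hol₁.1.continuous.prodMk hol₂.1.continuous).tendsto z
      rwa [hz₁, hz₂] at this
    filter_upwards [hleftM, hlim.eventually hHG] with x hx hxH
    rw [hxH]
    exact congrArg F hx.symm
  have hmain := hHd.norm_discAut_le hHb (mem_ball_zero_iff.1 (hB p)) (mem_ball_zero_iff.1 (hB q))
    (by rw [← hident]; exact hF.norm_lt_one q)
  rw [← hident, ← hident] at hmain
  -- Undoes the normalisation at `z`; Schwarz–Pick for the disc automorphism gives the direction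
  -- needed.
  have hsp : ∀ {K : M → ℂ}, IsHolToDisc E K →
      ‖discAut (discAut (K z) (K q)) (discAut (K z) (K p))‖ ≤ ‖discAut (K q) (K p)‖ := fun hK =>
    norm_discAut_le_of_mapsTo (differentiableOn_discAut (hK.norm_lt_one z))
      (fun t ht => mem_closedBall_zero_iff.2
        (norm_discAut_lt_one (hK.norm_lt_one z) (mem_ball_zero_iff.1 ht)).le)
      (hK.norm_lt_one p) (hK.norm_lt_one q)
      (norm_discAut_lt_one (hK.norm_lt_one z) (hK.norm_lt_one q))
  exact hmain.trans (max_le_max (hsp hF₁) (hsp hF₂))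

end

/-! ### Real derivatives and the complex structure. -/

section RealStructure

variable {E : Type*} [NormedAddCommGroup E] [NormedSpace ℂ E]
  {M : Type*} [TopologicalSpace M] [ChartedSpace E M]
  {E' : Type*} [NormedAddCommGroup E'] [NormedSpace ℂ E']
  {N : Type*} [TopologicalSpace N] [ChartedSpace E' N]

lemma mdifferentiableAt_complex_of_realDeriv {F : M → N} {z : M}
    (hF : MDifferentiableAt 𝓘(ℝ, E) 𝓘(ℝ, E') F z)
    (h : ∀ X, realDeriv E E' F z (Complex.I • X) = Complex.I • realDeriv E E' F z X) :
    MDifferentiableAt 𝓘(ℂ, E) 𝓘(ℂ, E') F z := by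
  rw [mdifferentiableAt_iff]
  refine ⟨hF.continuousAt, ?_⟩
  have h1 := hF.hasMFDerivAt.2
  simp only [mfld_simps] at h1
  have h2 : HasFDerivAt (chartAt E' (F z) ∘ F ∘ (chartAt E z).symm) (realDeriv E E' F z)
      (chartAt E z z) := hasFDerivWithinAt_univ.1 h1
  simp only [mfld_simps, differentiableWithinAt_univ]
  refine (differentiableAt_iff_restrictScalars ℝ h2.differentiableAt).2 ?_
  let T : E →L[ℂ] E' :=
    { toFun := realDeriv E E' F z
      map_add' := map_add _
      map_smul' := fun c X => by
        have e : c • X = c.re • X + c.im • Complex.I • X := by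
          rw [← Complex.coe_smul, ← Complex.coe_smul, smul_smul, ← add_smul, Complex.re_add_im]
        rw [e, map_add, (realDeriv E E' F z).map_smul, (realDeriv E E' F z).map_smul, h,
          ← Complex.coe_smul, ← Complex.coe_smul, smul_smul, ← add_smul, Complex.re_add_im]
        rfl
      cont := (realDeriv E E' F z).continuous }
  exact ⟨T, by rw [h2.fderiv]; rfl⟩

variable [IsManifold 𝓘(ℂ, E) ω M]

variable (E M) in
lemma isManifold_real : IsManifold 𝓘(ℝ, E) 1 M := by
  refine isManifold_of_contDiffOn _ _ _ fun e e' he he' => ?_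
  have h := ((contDiffGroupoid ω 𝓘(ℂ, E)).compatible he he').1
  exact (h.restrict_scalars ℝ).of_le le_top

lemma exists_complexLinear_tangentCoordChange {x y z : M} (hx : z ∈ (chartAt E x).source)
    (hy : z ∈ (chartAt E y).source) :
    haveI := isManifold_real E M
    ∃ T : E →L[ℂ] E, ∀ v, tangentCoordChange 𝓘(ℝ, E) x y z v = T v := by
  have := isManifold_real E M
  have hm : IsManifold 𝓘(ℂ, E) 1 M := IsManifold.of_le (n := ω) le_top
  have h1 := hasFDerivWithinAt_tangentCoordChange (I := 𝓘(ℂ, E)) (x := x) (y := y) (z := z)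
    (by simp [mfld_simps, hx, hy])
  have h2 := hasFDerivWithinAt_tangentCoordChange (I := 𝓘(ℝ, E)) (x := x) (y := y) (z := z)
    (by simp [mfld_simps, hx, hy])
  simp only [mfld_simps, hasFDerivWithinAt_univ] at h1 h2
  exact ⟨tangentCoordChange 𝓘(ℂ, E) x y z, fun v =>
    DFunLike.congr_fun (h2.unique (h1.restrictScalars ℝ)) v⟩

/-- In fixed tangent coordinates the derivative of a `C¹` map is continuous, and the coordinate
changes are complex linear, so they preserve the condition. -/
lemma isClosed_setOf_realDeriv_smul [IsManifold 𝓘(ℂ, E') ω N] {F : M → N} (hF : ContMDiff 𝓘(ℝ, E) 𝓘(ℝ, E') 1 F) (a b : ℂ) :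
    IsClosed {z : M | ∀ X, realDeriv E E' F z (a • X) = b • realDeriv E E' F z X} := by
  have := isManifold_real E M
  have := isManifold_real E' N
  refine isClosed_of_closure_subset fun z₀ hz₀ => ?_
  set B : M → E →L[ℝ] E' := inTangentCoordinates 𝓘(ℝ, E) 𝓘(ℝ, E') id F
    (mfderiv 𝓘(ℝ, E) 𝓘(ℝ, E') F) z₀ with hB
  have hBc : ContinuousAt B z₀ := ((hF z₀).mfderiv_const (m := 0) (by simp)).continuousAt
  have hBeq : ∀ z ∈ (chartAt E z₀).source, F z ∈ (chartAt E' (F z₀)).source → ∀ v, B z v =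
      tangentCoordChange 𝓘(ℝ, E') (F z) (F z₀) (F z)
        (realDeriv E E' F z (tangentCoordChange 𝓘(ℝ, E) z₀ z z v)) := fun z hz hFz v =>
    DFunLike.congr_fun (inTangentCoordinates_eq (I := 𝓘(ℝ, E)) (I' := 𝓘(ℝ, E')) id F
      (fun z => realDeriv E E' F z) (x₀ := z₀) (x := z) hz hFz) v
  have hnear : ∀ᶠ z in 𝓝 z₀, z ∈ (chartAt E z₀).source ∧ F z ∈ (chartAt E' (F z₀)).source :=
    (eventually_mem_set.2 ((chartAt E z₀).open_source.mem_nhds (mem_chart_source E z₀))).and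
      (hF.continuous.continuousAt.eventually
        ((chartAt E' (F z₀)).open_source.mem_nhds (mem_chart_source E' _)))
  have hfreq : ∃ᶠ z in 𝓝 z₀, B z ∈ {A : E →L[ℝ] E' | ∀ X, A (a • X) = b • A X} := by
    refine ((mem_closure_iff_frequently.1 hz₀).and_eventually hnear).mono ?_
    rintro z ⟨hz, hz1, hz2⟩ X
    obtain ⟨T, hT⟩ := exists_complexLinear_tangentCoordChange hz1 (mem_chart_source E z)
    obtain ⟨T', hT'⟩ := exists_complexLinear_tangentCoordChange (mem_chart_source E' (F z)) hz2
    rw [hBeq z hz1 hz2, hBeq z hz1 hz2, hT, hT, map_smul, hz, hT', hT', map_smul]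
  have hcl : IsClosed {A : E →L[ℝ] E' | ∀ X, A (a • X) = b • A X} := by
    simp only [ofPred_forall]
    refine isClosed_iInter fun X => isClosed_eq ?_ ?_
    · exact (ContinuousLinearMap.apply ℝ E' (a • X)).continuous
    · exact (ContinuousLinearMap.apply ℝ E' X).continuous.const_smul b
  have h0 := hcl.mem_of_frequently_of_tendsto hfreq hBc
  have hself : ∀ v, B z₀ v = realDeriv E E' F z₀ v := by
    intro v
    rw [hBeq z₀ (mem_chart_source E z₀) (mem_chart_source E' _),
      tangentCoordChange_self (mem_extChartAt_source z₀),
      tangentCoordChange_self (mem_extChartAt_source (F z₀))]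
  intro X
  rw [← hself, ← hself]
  exact h0 X

end RealStructure

/-! ### Exclusion of the exceptional case and conclusion. -/

section

variable {E : Type*} [NormedAddCommGroup E] [NormedSpace ℂ E]
  {M : Type*} [TopologicalSpace M] [T2Space M] [ConnectedSpace M] [ChartedSpace E M]
  [IsManifold 𝓘(ℂ, E) ω M]

/-- A minimal Carathéodory universal set with at least three elements has no two elements that
determine the Carathéodory metric at a point. -/
lemma not_exists_pair_of_minimal (hE : Module.finrank ℂ E = 2) (hM : IsLempertManifold E M)
    {S : Set (M → ℂ)} (hS : IsMinimalCaratheodoryUniversal E S) (hfin : S.Finite)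
    (hcard : 3 ≤ S.ncard) (z : M) :
    ¬ ∃ F₁ F₂ : S, ∀ (G : S) (X : E), ‖poincareDeriv E G.1 z X‖ ≤
      max ‖poincareDeriv E F₁.1 z X‖ ‖poincareDeriv E F₂.1 z X‖ := by
  rintro ⟨⟨F₁, hF₁⟩, ⟨F₂, hF₂⟩, h⟩
  have hne : S.Nonempty := ⟨F₁, hF₁⟩
  have h1 := hS.prop.1 F₁ hF₁
  have h2 := hS.prop.1 F₂ hF₂
  have hmax : ∀ X : E, caratheodoryMetric E z X =
      max ‖poincareDeriv E F₁ z X‖ₑ ‖poincareDeriv E F₂ z X‖ₑ := by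
    intro X
    rw [caratheodoryMetric_eq_iSup hS.prop hfin hne]
    refine le_antisymm (iSup_le fun G => ?_) (max_le ?_ ?_)
    · rcases le_max_iff.1 (h G X) with h' | h'
      · exact le_max_of_le_left (enorm_le_iff_norm_le.2 h')
      · exact le_max_of_le_right (enorm_le_iff_norm_le.2 h')
    · exact le_iSup (fun G : S => ‖poincareDeriv E G.1 z X‖ₑ) ⟨F₁, hF₁⟩
    · exact le_iSup (fun G : S => ‖poincareDeriv E G.1 z X‖ₑ) ⟨F₂, hF₂⟩
  have huniv := isCaratheodoryUniversal_pair h1 h2 fun F hF p q =>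
    norm_discAut_le_max_of_metric_eq_max hE hM.taut hM.metric_eq h1 h2 hmax hF p q
  have hsub : S ⊆ {F₁, F₂} := hS.2 huniv (by rintro F (rfl | rfl) <;> assumption)
  have := (ncard_le_ncard hsub (by simp)).trans (ncard_insert_le F₁ {F₂})
  rw [ncard_singleton] at this
  omega

end

theorem theorem2
    {E : Type*} [NormedAddCommGroup E] [NormedSpace ℂ E] (hE : Module.finrank ℂ E = 2)
    {E' : Type*} [NormedAddCommGroup E'] [NormedSpace ℂ E'] (hE' : Module.finrank ℂ E' = 2)
    {M : Type*} [TopologicalSpace M] [T2Space M] [SecondCountableTopology M] [ConnectedSpace M]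
    [ChartedSpace E M] [IsManifold 𝓘(ℂ, E) ω M]
    {N : Type*} [TopologicalSpace N] [T2Space N] [SecondCountableTopology N] [ConnectedSpace N]
    [ChartedSpace E' N] [IsManifold 𝓘(ℂ, E') ω N]
    (hM : IsLempertManifold E M) (hN : IsLempertManifold E' N)
    (hSM : ∃ S : Set (M → ℂ), IsMinimalCaratheodoryUniversal E S ∧ S.Finite ∧ 3 ≤ S.ncard)
    (hSN : ∃ S : Set (N → ℂ), IsMinimalCaratheodoryUniversal E' S ∧ S.Finite ∧ 3 ≤ S.ncard)
    (F : M → N) (hF : IsKobayashiIsometry E E' F) :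
    IsHol E E' F ∨ IsAntiHol E E' F := by
  obtain ⟨S, hS, hSf, hSc⟩ := hSM
  obtain ⟨S', hS', hSf', hSc'⟩ := hSN
  have hSne : S.Nonempty := nonempty_of_ncard_ne_zero (by omega)
  have hSne' : S'.Nonempty := nonempty_of_ncard_ne_zero (by omega)
  have hnt : Nontrivial E := Module.nontrivial_of_finrank_pos (R := ℂ) (by omega)
  have hcar : ∀ (z : M) (X : E), ⨆ G : S, ‖poincareDeriv E G.1 z X‖ₑ =
      ⨆ G : S', ‖poincareDeriv E' G.1 (F z) (realDeriv E E' F z X)‖ₑ := fun z X => by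
    rw [← caratheodoryMetric_eq_iSup hS.prop hSf hSne, ← hM.metric_eq, hF.isometry, hN.metric_eq,
      caratheodoryMetric_eq_iSup hS'.prop hSf' hSne']
  have hpos : ∀ (z : M) (X : E), (⨆ G : S, ‖poincareDeriv E G.1 z X‖ₑ = 0) → X = 0 := by
    intro z X h
    by_contra hX
    have := kobayashiMetric_pos hM.taut z hX
    rw [hM.metric_eq, caratheodoryMetric_eq_iSup hS.prop hSf hSne, h] at this
    exact lt_irrefl _ this
  have := hSf.to_subtype
  have := hSf'.to_subtype
  have hdich : ∀ z : M, ∃ σ : ℝ, (σ = 1 ∨ σ = -1) ∧ ∀ X,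
      realDeriv E E' F z (Complex.I • X) = ((σ : ℂ) * Complex.I) • realDeriv E E' F z X := by
    intro z
    refine (linear_or_antilinear_or_exists_pair hE hE' (fun G : S => poincareDeriv E G.1 z)
      (fun G : S' => poincareDeriv E' G.1 (F z)) (realDeriv E E' F z) (hcar z)
      fun X hX => hpos z X ?_).resolve_right (not_exists_pair_of_minimal hE hM hS hSf hSc z)
    simp [hX]
  set Z : ℂ → Set M := fun b =>
    {z | ∀ X, realDeriv E E' F z (Complex.I • X) = b • realDeriv E E' F z X} with hZ
  have hclosed : ∀ b, IsClosed (Z b) := isClosed_setOf_realDeriv_smul hF.contMDiff Complex.I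
  have hcover : ∀ z, z ∈ Z Complex.I ∨ z ∈ Z (-Complex.I) := by
    intro z
    obtain ⟨σ, rfl | rfl, h⟩ := hdich z
    · exact Or.inl fun X => by simpa using h X
    · exact Or.inr fun X => by simpa using h X
  have hdisj : ∀ z, z ∈ Z Complex.I → z ∉ Z (-Complex.I) := by
    intro z h1 h2
    obtain ⟨X, hX⟩ := exists_ne (0 : E)
    have e := (h1 X).symm.trans (h2 X)
    rw [← sub_eq_zero, ← sub_smul, smul_eq_zero, sub_neg_eq_add, add_self_eq_zero] at e
    have e' : realDeriv E E' F z X = 0 := e.resolve_left Complex.I_ne_zero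
    refine hX (hpos z X ?_)
    rw [hcar, e']
    simp
  have hcompl : (Z Complex.I)ᶜ = Z (-Complex.I) :=
    ext fun z => ⟨(hcover z).resolve_left, fun h h' => hdisj z h' h⟩
  have hmd : MDifferentiable 𝓘(ℝ, E) 𝓘(ℝ, E') F := hF.contMDiff.mdifferentiable one_ne_zero
  have hclopen : IsClopen (Z Complex.I) :=
    ⟨hclosed _, isClosed_compl_iff.1 (hcompl ▸ hclosed _)⟩
  rcases isClopen_iff.1 hclopen with h | h
  · right
    refine ⟨hmd, fun z c X => ?_⟩
    have hz : z ∈ Z (-Complex.I) := by rw [← hcompl, h]; simp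
    have e : c • X = c.re • X + c.im • Complex.I • X := by
      rw [← Complex.coe_smul, ← Complex.coe_smul, smul_smul, ← add_smul, Complex.re_add_im]
    rw [e, map_add, (realDeriv E E' F z).map_smul, (realDeriv E E' F z).map_smul, hz X,
      ← Complex.coe_smul, ← Complex.coe_smul, smul_smul, ← add_smul]
    congr 1
    rw [mul_neg, ← sub_eq_add_neg]
    apply Complex.ext <;> simp
  · left
    intro z
    have hz : z ∈ Z Complex.I := h ▸ mem_univ z
    exact mdifferentiableAt_complex_of_realDeriv (hmd z) hz
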